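/- **Proposition.** Let $\tau\in\mathbb{C}$ with $\operatorname{Im}\tau>0$, write $q^{s}=e^{2\pi i s\tau}$ for $s\in\mathbb{C}$, and let $(-i\tau)^{1/2}$ denote the principal branch. For $a,b\in\{0,1\}$ let $$\vartheta_{ab}(\tau,z)=\sum_{n\in\mathbb{Z}}e^{\pi i(n+\frac a2)^2\tau+2\pi i(n+\frac a2)(z+\frac b2)}$$ be Mumford's theta functions. Define $$f_1=\sum_{j\in\mathbb{Z}}\frac{e^{2\pi ijz}q^{\frac12j^2}}{1-e^{2\pi iz}q^{j}},\quad f_2=\sum_{j\in\mathbb{Z}}(-1)^j\frac{e^{2\pi i(j+\frac12)z}q^{\frac12(j+\frac12)^2}}{1+e^{2\pi iz}q^{j+\frac12}},\quad f_3=\sum_{j\in\mathbb{Z}}(-1)^j\frac{e^{2\pi ijz}q^{\frac12j^2}}{1+e^{2\pi iz}q^{j}},\quad f_4=\sum_{j\in\mathbb{Z}}\frac{e^{2\pi i(j+\frac12)z}q^{\frac12(j+\frac12)^2}}{1-e^{2\pi iz}q^{j+\frac12}},$$ $$g_1=\sum_{j\in\mathbb{Z}}\frac{e^{2\pi i(j-\frac12)z}q^{\frac12j(j-1)}}{1-e^{2\pi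 iz}q^{j}},\quad g_2=\sum_{j\in\mathbb{Z}}(-1)^j\frac{e^{2\pi i(j-\frac12)z}q^{\frac12j(j-1)}}{1+e^{2\pi iz}q^{j}},\quad g_3=\sum_{j\in\mathbb{Z}}\frac{e^{2\pi ijz}q^{\frac12(j^2-\frac14)}}{1-e^{2\pi iz}q^{j+\frac12}},\quad g_4=\sum_{j\in\mathbb{Z}}(-1)^j\frac{e^{2\pi ijz}q^{\frac12(j^2-\frac14)}}{1+e^{2\pi iz}q^{j+\frac12}},$$ $$h_1=\sum_{j\in\mathbb{Z}}(-1)^j\frac{e^{2\pi ijz}q^{\frac12j^2}}{1-e^{2\pi iz}q^{j}},\quad h_2=\sum_{j\in\mathbb{Z}}(-1)^j\frac{e^{2\pi i(j+\frac12)z}q^{\frac12(j+\frac12)^2}}{1-e^{2\pi iz}q^{j+\frac12}},\quad h_3=\sum_{j\in\mathbb{Z}}\frac{e^{2\pi ijz}q^{\frac12j^2}}{1+e^{2\pi iz}q^{j}},\quad h_4=\sum_{j\in\mathbb{Z}}\frac{e^{2\pi i(j+\frac12)z}q^{\frac12(j+\frac12)^2}}{1+e^{2\pi iz}q^{j+\frac12}},$$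 all as functions of $(\tau,z)$. Then each of the following identities holds for every $z\in\mathbb{C}$ at which no denominator in it vanishes (the functions without displayed argument, on the right-hand sides, are taken at $(\tau,z)$). 1) $S$-transformation: $$\begin{aligned} f_1(-\tfrac1\tau,\tfrac z\tau)&=e^{\pi iz^2/\tau}\{\tau f_1-\tfrac12\tau\vartheta_{00}+\tfrac12(-i\tau)^{1/2}\vartheta_{00}\},\\ f_2(-\tfrac1\tau,\tfrac z\tau)&=e^{\pi iz^2/\tau}\{-i\tau f_2+\tfrac12\tau\vartheta_{11}-\tfrac12(-i\tau)^{1/2}\vartheta_{11}\},\\ f_3(-\tfrac1\tau,\tfrac z\tau)&=e^{\pi iz^2/\tau}\{\tau f_4-\tfrac12\tau\vartheta_{10}+\tfrac12(-i\tau)^{1/2}\vartheta_{10}\},\\ f_4(-\tfrac1\tau,\tfrac z\tau)&=e^{\pi iz^2/\tau}\{\tau f_3-\tfrac12\tau\vartheta_{01}+\tfrac12(-i\tau)^{1/2}\vartheta_{01}\},\\ g_1(-\tfrac1\tau,\tfrac z\tau)&=e^{\pi iz^2/\tau}\{\tau h_1-\tfrac12\tau\vartheta_{01}\}+(-i\tau)^{1/2}e^{\frac{\pi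 i}\tau(z^2+\frac14)}\vartheta_{01},\\ g_2(-\tfrac1\tau,\tfrac z\tau)&=e^{\pi iz^2/\tau}\{i\tau h_2-\tfrac12\tau\vartheta_{11}\}+(-i\tau)^{1/2}e^{\frac{\pi i}\tau(z^2+\frac14)}\vartheta_{11},\\ g_3(-\tfrac1\tau,\tfrac z\tau)&=e^{\pi iz^2/\tau}\{\tau h_3-\tfrac12\tau\vartheta_{00}\}+(-i\tau)^{1/2}e^{\frac{\pi i}\tau(z^2+\frac14)}\vartheta_{00},\\ g_4(-\tfrac1\tau,\tfrac z\tau)&=e^{\pi iz^2/\tau}\{\tau h_4-\tfrac12\tau\vartheta_{10}\}+(-i\tau)^{1/2}e^{\frac{\pi i}\tau(z^2+\frac14)}\vartheta_{10},\\ h_1(-\tfrac1\tau,\tfrac z\tau)&=e^{\pi iz^2/\tau}\{\tau g_1-\tau q^{-\frac18}\vartheta_{10}+\tfrac12(-i\tau)^{1/2}\vartheta_{10}\},\\ h_2(-\tfrac1\tau,\tfrac z\tau)&=e^{\pi iz^2/\tau}\{i\tau g_2+\tau q^{-\frac18}\vartheta_{11}-\tfrac12(-i\tau)^{1/2}\vartheta_{11}\},\\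 h_3(-\tfrac1\tau,\tfrac z\tau)&=e^{\pi iz^2/\tau}\{\tau g_3-\tau q^{-\frac18}\vartheta_{00}+\tfrac12(-i\tau)^{1/2}\vartheta_{00}\},\\ h_4(-\tfrac1\tau,\tfrac z\tau)&=e^{\pi iz^2/\tau}\{\tau g_4-\tau q^{-\frac18}\vartheta_{01}+\tfrac12(-i\tau)^{1/2}\vartheta_{01}\}. \end{aligned}$$ 2) $T$-transformation: $$\begin{aligned} &f_1(\tau+1,z)=h_1,&&f_2(\tau+1,z)=e^{\pi i/4}h_2,&&f_3(\tau+1,z)=h_3,&&f_4(\tau+1,z)=e^{\pi i/4}h_4,\\ &g_1(\tau+1,z)=g_1,&&g_2(\tau+1,z)=g_2,&&g_3(\tau+1,z)=e^{-\pi i/4}g_4,&&g_4(\tau+1,z)=e^{-\pi i/4}g_3,\\ &h_1(\tau+1,z)=f_1,&&h_2(\tau+1,z)=e^{\pi i/4}f_2,&&h_3(\tau+1,z)=f_3,&&h_4(\tau+1,z)=e^{\pi i/4}f_4. \end{aligned}$$ -/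

import Mathlib

open Complex
open scoped Real

noncomputable section

namespace AppellSum

/-- The power `q ^ s` of the nome `q = exp (2 π i τ)`, that is `exp (2 π i s τ)`. -/
def qPow (τ s : ℂ) : ℂ := exp (2 * π * I * s * τ)

/-- Mumford's theta function `ϑ₀₀(τ, z) = ∑_{n ∈ ℤ} exp (π i n² τ + 2 π i n z)`. -/
def theta00 (τ z : ℂ) : ℂ := jacobiTheta₂ z τ

/-- `ϑ₀₁(τ, z) = ∑_{n ∈ ℤ} exp (π i n² τ + 2 π i n (z + 1/2))`. -/
def theta01 (τ z : ℂ) : ℂ := jacobiTheta₂ (z + 1 / 2) τ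

/-- `ϑ₁₀(τ, z) = ∑_{n ∈ ℤ} exp (π i (n + 1/2)² τ + 2 π i (n + 1/2) z)`. -/
def theta10 (τ z : ℂ) : ℂ := exp (π * I * τ / 4 + π * I * z) * jacobiTheta₂ (z + τ / 2) τ

/-- `ϑ₁₁(τ, z) = ∑_{n ∈ ℤ} exp (π i (n + 1/2)² τ + 2 π i (n + 1/2) (z + 1/2))`. -/
def theta11 (τ z : ℂ) : ℂ :=
  exp (π * I * τ / 4 + π * I * (z + 1 / 2)) * jacobiTheta₂ (z + (1 + τ) / 2) τ

/-- `w` is not a point of the lattice `ℤ τ + ℤ`. -/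
def OffLattice (τ w : ℂ) : Prop := ∀ m n : ℤ, w ≠ m * τ + n

def f1 (τ z : ℂ) : ℂ :=
  ∑' j : ℤ, (exp (2 * π * I * j * z) * qPow τ ((j : ℂ) ^ 2 / 2)) /
    (1 - exp (2 * π * I * z) * qPow τ j)

def f2 (τ z : ℂ) : ℂ :=
  ∑' j : ℤ, (-1 : ℂ) ^ j * (exp (2 * π * I * (j + 1 / 2) * z) * qPow τ (((j : ℂ) + 1 / 2) ^ 2 / 2)) /
    (1 + exp (2 * π * I * z) * qPow τ (j + 1 / 2))

def f3 (τ z : ℂ) : ℂ :=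
  ∑' j : ℤ, (-1 : ℂ) ^ j * (exp (2 * π * I * j * z) * qPow τ ((j : ℂ) ^ 2 / 2)) /
    (1 + exp (2 * π * I * z) * qPow τ j)

def f4 (τ z : ℂ) : ℂ :=
  ∑' j : ℤ, (exp (2 * π * I * (j + 1 / 2) * z) * qPow τ (((j : ℂ) + 1 / 2) ^ 2 / 2)) /
    (1 - exp (2 * π * I * z) * qPow τ (j + 1 / 2))

def g1 (τ z : ℂ) : ℂ :=
  ∑' j : ℤ, (exp (2 * π * I * (j - 1 / 2) * z) * qPow τ ((j : ℂ) * (j - 1) / 2)) /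
    (1 - exp (2 * π * I * z) * qPow τ j)

def g2 (τ z : ℂ) : ℂ :=
  ∑' j : ℤ, (-1 : ℂ) ^ j * (exp (2 * π * I * (j - 1 / 2) * z) * qPow τ ((j : ℂ) * (j - 1) / 2)) /
    (1 + exp (2 * π * I * z) * qPow τ j)

def g3 (τ z : ℂ) : ℂ :=
  ∑' j : ℤ, (exp (2 * π * I * j * z) * qPow τ (((j : ℂ) ^ 2 - 1 / 4) / 2)) /
    (1 - exp (2 * π * I * z) * qPow τ (j + 1 / 2))

def g4 (τ z : ℂ) : ℂ :=
  ∑' j : ℤ, (-1 : ℂ) ^ j * (exp (2 * π * I * j * z) * qPow τ (((j : ℂ) ^ 2 - 1 / 4) / 2)) /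
    (1 + exp (2 * π * I * z) * qPow τ (j + 1 / 2))

def h1 (τ z : ℂ) : ℂ :=
  ∑' j : ℤ, (-1 : ℂ) ^ j * (exp (2 * π * I * j * z) * qPow τ ((j : ℂ) ^ 2 / 2)) /
    (1 - exp (2 * π * I * z) * qPow τ j)

def h2 (τ z : ℂ) : ℂ :=
  ∑' j : ℤ, (-1 : ℂ) ^ j * (exp (2 * π * I * (j + 1 / 2) * z) * qPow τ (((j : ℂ) + 1 / 2) ^ 2 / 2)) /
    (1 - exp (2 * π * I * z) * qPow τ (j + 1 / 2))

def h3 (τ z : ℂ) : ℂ :=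
  ∑' j : ℤ, (exp (2 * π * I * j * z) * qPow τ ((j : ℂ) ^ 2 / 2)) /
    (1 + exp (2 * π * I * z) * qPow τ j)

def h4 (τ z : ℂ) : ℂ :=
  ∑' j : ℤ, (exp (2 * π * I * (j + 1 / 2) * z) * qPow τ (((j : ℂ) + 1 / 2) ^ 2 / 2)) /
    (1 + exp (2 * π * I * z) * qPow τ (j + 1 / 2))

end AppellSum

end

open AppellSum

open Filter Topology

namespace AppellSum

/-! ### Entire odd quasi-periodic functions vanish -/

/-! Write e(w) = exp(2πiw). Up to an elementary exponential factor, each of the twelve functions is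
one Appell–Lerch sum `lerchSum τ c w` at w = z + (0, 1/2, τ/2 or (1+τ)/2). The numerator shift is c
= 0 for the f's, c = 1/2 for the h's and c = -τ/2 for the g's. So S needs only three inversion
formulas and T only one formula; the rest is bookkeeping of half-periods and exponentials.

An inversion formula is proved by uniqueness. Multiply the inverted sum by the inverse Gaussian
exp(-πiz²/τ), and by a further exponential if c requires it, then subtract τ times the original sum.
The result D is 1-periodic and satisfies D(z+τ) = k e(-z) D(z). The poles lie on the lattice and are
simple; the residues at 0 cancel, and quasi-periodicity carries the cancellation to every lattice
point, so D extends to an entire function. The Fourier coefficients of such a function obey a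
first-order recursion, so the 0-th one determines it. A theta function with the same multipliers may
be added to D, and its coefficient is chosen to make D odd. Then the 0-th coefficient vanishes and D
= 0 (`eq_zero_of_odd_quasiperiodic`, `lerchSum_inversion_eq_of_odd`).

Oddness is checked with the reflection formula `lerchSum_neg`, the numerator shift
`exp_mul_lerchSum_add_numerator_tau` and Jacobi's inversion of theta, which is where (-iτ)^{1/2}
enters. This handles c = 0 and the passage from -τ/2 to 1/2; the passage from 1/2 to -τ/2 follows by
applying the latter at (-1/τ, z/τ), since S² sends (τ, z) to (τ, -z). -/

/-- The integral of a `1`-periodic entire function over a unit horizontal segment does not depend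
on the position of the segment. -/
theorem integral_shift_of_periodic {P : ℂ → ℂ} (hP : Differentiable ℂ P)
    (h1 : ∀ z, P (z + 1) = P z) (w : ℂ) :
    ∫ x in (0 : ℝ)..1, P (x + w) = ∫ x in (0 : ℝ)..1, P x := by
  -- The integral over the segment from v to v + 1 is Q(v+1) - Q(v) for a primitive Q, and
  -- periodicity of P makes the derivative in v vanish. The radius leaves room for v + x with ‖v‖ <
  -- ‖w‖ + 1 and 0 ≤ x ≤ 1.
  obtain ⟨Q, hQ⟩ := (hP.differentiableOn (s := Metric.ball (0 : ℂ) (‖w‖ + 3))).isExactOn_ball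
  have key : ∀ v : ℂ, ‖v‖ < ‖w‖ + 1 → ∫ x in (0 : ℝ)..1, P (x + v) = Q (v + 1) - Q v := by
    intro v hv
    have := intervalIntegral.integral_eq_sub_of_hasDerivAt (a := 0) (b := 1)
      (f := fun x : ℝ => Q (x + v)) (f' := fun x : ℝ => P (x + v)) ?_ ?_
    · rw [this]; simp [add_comm]
    · intro x hx
      rw [Set.uIcc_of_le zero_le_one] at hx
      have hm : (x + v : ℂ) ∈ Metric.ball (0 : ℂ) (‖w‖ + 3) := by
        rw [mem_ball_zero_iff]
        have h2 : ‖(x : ℂ)‖ ≤ 1 := by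
          rw [Complex.norm_real, Real.norm_of_nonneg hx.1]; exact hx.2
        linarith [norm_add_le (x : ℂ) v]
      have h3 : HasDerivAt (fun y : ℂ => Q (y + v)) (P (x + v)) (x : ℂ) :=
        (hQ _ hm).comp_add_const _ _
      exact h3.comp_ofReal
    · apply Continuous.intervalIntegrable
      have := hP.continuous
      fun_prop
  have hd : ∀ v ∈ Metric.ball (0 : ℂ) (‖w‖ + 1),
      HasDerivAt (fun v => Q (v + 1) - Q v) 0 v := by
    intro v hv
    rw [mem_ball_zero_iff] at hv
    have a1 : HasDerivAt Q (P v) v := hQ _ (by rw [mem_ball_zero_iff]; linarith)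
    have a2 : HasDerivAt (fun y => Q (y + 1)) (P (v + 1)) v :=
      (hQ _ (by rw [mem_ball_zero_iff]
                have := norm_add_le v 1
                rw [norm_one] at this
                linarith)).comp_add_const _ _
    have := a2.sub a1
    rwa [h1, sub_self] at this
  have hc : Q (w + 1) - Q w = Q (0 + 1) - Q 0 := by
    refine Metric.isOpen_ball.is_const_of_deriv_eq_zero (𝕜 := ℂ)
      (convex_ball (0 : ℂ) (‖w‖ + 1)).isPreconnected
      (f := fun v => Q (v + 1) - Q v)
      (fun v hv => (hd v hv).differentiableAt.differentiableWithinAt)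
      (fun v hv => (hd v hv).deriv) ?_ ?_
    · rw [mem_ball_zero_iff]; linarith
    · rw [mem_ball_zero_iff, norm_zero]; positivity
  rw [key w (by linarith), hc, ← key 0 (by rw [norm_zero]; positivity)]
  simp

/-- A continuous `1`-periodic function on the real line with vanishing Fourier coefficients is
zero. -/
theorem eq_zero_of_fourier_integral_eq_zero {F : ℝ → ℂ} (hF : Continuous F)
    (h1 : ∀ x, F (x + 1) = F x)
    (hc : ∀ n : ℤ, ∫ x in (0 : ℝ)..1, exp (-(2 * π * I * n * x)) * F x = 0) (x : ℝ) :
    F x = 0 := by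
  have hp : Function.Periodic F 1 := h1
  let G : C(AddCircle (1 : ℝ), ℂ) := ⟨hp.lift, hF.quotient_liftOn' _⟩
  have : Fact ((0 : ℝ) < 1) := ⟨one_pos⟩
  have hz : ∀ n : ℤ, fourierCoeff G n = 0 := by
    intro n
    rw [fourierCoeff_eq_intervalIntegral G n 0]
    have e : ∀ y : ℝ, fourier (-n) (y : AddCircle (1 : ℝ)) • G (y : AddCircle (1 : ℝ)) =
        exp (-(2 * π * I * n * y)) * F y := by
      intro y
      rw [fourier_coe_apply, smul_eq_mul]
      have : G (y : AddCircle (1 : ℝ)) = F y := hp.lift_coe y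
      rw [this]
      congr 2
      push_cast
      ring
    simp only [e, zero_add, hc, smul_zero]
  have hs : fourierCoeff G = 0 := funext hz
  -- The zero family of coefficients is summable, so the Fourier series converges pointwise to the
  -- function, and its sum is 0.
  have := has_pointwise_sum_fourier_series_of_summable (f := G)
    (by rw [hs]; exact summable_zero) (x : AddCircle (1 : ℝ))
  simp only [hz, zero_smul] at this
  have h0 := this.unique hasSum_zero
  have e : G (x : AddCircle (1 : ℝ)) = F x := hp.lift_coe x
  rw [← e, h0]

/-- The two quasi-periods link consecutive Fourier coefficients by nonzero factors, so one vanishing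
coefficient kills all of them. Oddness supplies the vanishing of the 0-th. -/
theorem eq_zero_of_odd_quasiperiodic {N : ℂ → ℂ} {τ k : ℂ} (hN : Differentiable ℂ N)
    (hk : k ≠ 0) (h1 : ∀ z, N (z + 1) = N z)
    (hτ : ∀ z, N (z + τ) = k * exp (-(2 * π * I * z)) * N z)
    (hodd : ∀ z, N (-z) = -N z) : N = 0 := by
  have hcont := hN.continuous
  set c : ℤ → ℂ := fun n => ∫ x in (0 : ℝ)..1, exp (-(2 * π * I * n * x)) * N x with hcdef
  -- Move the segment of integration by τ: the factor e(-z) in the quasi-periodicity raises the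
  -- index by one.
  have hrec : ∀ n : ℤ, c n = k * exp (-(2 * π * I * n * τ)) * c (n + 1) := by
    intro n
    have := integral_shift_of_periodic (P := fun z => exp (-(2 * π * I * n * z)) * N z)
      (by fun_prop) (fun z => by
        rw [h1, show -(2 * π * I * n * (z + 1)) = -(2 * π * I * n * z) + (-n : ℤ) * (2 * π * I) by
          push_cast; ring, exp_add, exp_int_mul_two_pi_mul_I, mul_one]) τ
    rw [hcdef]
    simp only at this ⊢
    rw [← this, ← intervalIntegral.integral_const_mul]
    congr 1
    funext x
    rw [hτ]
    rw [show -(2 * π * I * n * (x + τ)) = -(2 * π * I * n * x) + -(2 * π * I * n * τ) by ring,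
      show -(2 * π * I * (n + 1 : ℤ) * x) = -(2 * π * I * n * x) + -(2 * π * I * x) by
        push_cast; ring, exp_add, exp_add]
    ring
  have h0 : c 0 = 0 := by
    have e0 : c 0 = ∫ x in (0 : ℝ)..1, N x := by simp [hcdef]
    -- Substitute x ↦ 1 - x, then use periodicity and oddness.
    have e1 : ∫ x in (0 : ℝ)..1, N x = -∫ x in (0 : ℝ)..1, N x := by
      rw [← intervalIntegral.integral_neg]
      have := intervalIntegral.integral_comp_sub_left (a := 0) (b := 1) (fun x : ℝ => N x) 1
      simp only [sub_self, sub_zero] at this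
      rw [← this]
      congr 1
      funext x
      push_cast
      rw [← hodd, ← h1 (-x)]
      congr 1
      ring
    rw [e0]
    linear_combination e1 / 2
  have hall : ∀ n, c n = 0 := by
    intro n
    induction n using Int.induction_on with
    | zero => exact h0
    | succ i ih =>
      rw [hrec] at ih
      simpa [hk, exp_ne_zero] using ih
    | pred i ih =>
      rw [hrec, sub_add_cancel, ih, mul_zero]
  have hreal : ∀ x : ℝ, N x = 0 := by
    apply eq_zero_of_fourier_integral_eq_zero (F := fun x : ℝ => N x) (by fun_prop)
    · intro x; push_cast; exact h1 _
    · exact hall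
  have han : AnalyticOnNhd ℂ N Set.univ := fun z _ => hN.analyticAt z
  refine han.eq_of_frequently_eq (z₀ := 0) (fun z _ => analyticAt_const) ?_
  have ht : Tendsto (fun x : ℝ => (x : ℂ)) (𝓝[≠] 0) (𝓝[≠] 0) := by
    refine tendsto_nhdsWithin_iff.2 ⟨?_, ?_⟩
    · exact (Complex.continuous_ofReal.tendsto' 0 0 (by simp)).mono_left nhdsWithin_le_nhds
    · filter_upwards [self_mem_nhdsWithin] with x hx
      simpa using hx
  exact ht.frequently (Eventually.of_forall fun x => hreal x).frequently

/-! ### Removable singularities -/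

/-- A function that agrees near every point, the point excepted, with an analytic function is
equal to an entire function at each of its points of continuity. -/
theorem exists_entire_of_removable {D : ℂ → ℂ}
    (h : ∀ p, ∃ g : ℂ → ℂ, AnalyticAt ℂ g p ∧ D =ᶠ[𝓝[≠] p] g) :
    ∃ N : ℂ → ℂ, Differentiable ℂ N ∧ ∀ p, ContinuousAt D p → N p = D p := by
  choose g hg hD using h
  have hlim : ∀ p, Tendsto D (𝓝[≠] p) (𝓝 (g p p)) := fun p =>
    (((hg p).continuousAt.tendsto).mono_left nhdsWithin_le_nhds).congr' (hD p).symm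
  refine ⟨fun p => g p p, fun p => ?_, fun p hp =>
    tendsto_nhds_unique (hlim p) (hp.tendsto.mono_left nhdsWithin_le_nhds)⟩
  -- Near p, but off p, both sides are the limit of D at q, hence equal; so the function of limiting
  -- values is locally the analytic function `g p`.
  have hloc : (fun q => g q q) =ᶠ[𝓝 p] g p := by
    have h2 : ∀ᶠ q in 𝓝[≠] p, g q q = g p q := by
      have h3 : ∀ᶠ q in 𝓝[≠] p, AnalyticAt ℂ (g p) q :=
        (hg p).eventually_analyticAt.filter_mono nhdsWithin_le_nhds
      have h4 : ∀ᶠ q in 𝓝[≠] p, ∀ᶠ w in 𝓝 q, w ≠ p → D w = g p w :=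
        (eventually_eventually_nhds.2
          (eventually_nhdsWithin_iff.1 (hD p))).filter_mono nhdsWithin_le_nhds
      filter_upwards [h3, h4, self_mem_nhdsWithin] with q hq3 hq4 hqp
      have h5 : D =ᶠ[𝓝 q] g p := by
        filter_upwards [hq4, isOpen_ne.mem_nhds hqp] with w hw hwp using hw hwp
      refine tendsto_nhds_unique (hlim q) ?_
      exact ((hq3.continuousAt.tendsto).congr' h5.symm).mono_left nhdsWithin_le_nhds
    rw [eventually_nhdsWithin_iff] at h2
    filter_upwards [h2] with q hq
    by_cases hqp : q = p
    · rw [hqp]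
    · exact hq hqp
  exact ((hg p).congr hloc.symm).differentiableAt

/-- `f` has at `0` at most a simple pole, of residue `r`. -/
def HasResidueAtZero (f : ℂ → ℂ) (r : ℂ) : Prop :=
  ∃ a : ℂ → ℂ, AnalyticAt ℂ a 0 ∧ a 0 = r ∧ f =ᶠ[𝓝[≠] 0] fun z => a z / z

/-- With a(0) = 0, the quotient a(z)/z is the difference quotient of a at 0, which extends
analytically. -/
theorem HasResidueAtZero.removable {f : ℂ → ℂ} (h : HasResidueAtZero f 0) :
    ∃ g : ℂ → ℂ, AnalyticAt ℂ g 0 ∧ f =ᶠ[𝓝[≠] 0] g := by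
  obtain ⟨a, ha, h0, hf⟩ := h
  obtain ⟨p, hp⟩ := ha
  refine ⟨dslope a 0, hp.has_fpower_series_dslope_fslope.analyticAt, ?_⟩
  filter_upwards [hf, self_mem_nhdsWithin] with z hz hne
  rw [hz, dslope_of_ne _ hne, slope_def_field, h0]
  simp

theorem HasResidueAtZero.add {f g : ℂ → ℂ} {r s : ℂ} (hf : HasResidueAtZero f r)
    (hg : HasResidueAtZero g s) : HasResidueAtZero (fun z => f z + g z) (r + s) := by
  obtain ⟨a, ha, h0, hf⟩ := hf
  obtain ⟨b, hb, h0', hg⟩ := hg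
  refine ⟨fun z => a z + b z, ha.add hb, by simp [h0, h0'], ?_⟩
  filter_upwards [hf, hg] with z h1 h2
  rw [h1, h2, add_div]

theorem HasResidueAtZero.mul_left {f g : ℂ → ℂ} {r : ℂ} (hf : HasResidueAtZero f r)
    (hg : AnalyticAt ℂ g 0) : HasResidueAtZero (fun z => g z * f z) (g 0 * r) := by
  obtain ⟨a, ha, h0, hf⟩ := hf
  refine ⟨fun z => g z * a z, hg.mul ha, by simp [h0], ?_⟩
  filter_upwards [hf] with z h1
  rw [h1, mul_div_assoc]

theorem HasResidueAtZero.of_analyticAt {f : ℂ → ℂ} (hf : AnalyticAt ℂ f 0) :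
    HasResidueAtZero f 0 := by
  refine ⟨fun z => z * f z, analyticAt_id.mul hf, by simp, ?_⟩
  filter_upwards [self_mem_nhdsWithin] with z hne
  rw [mul_div_cancel_left₀ _ hne]

theorem HasResidueAtZero.comp_div {f : ℂ → ℂ} {r τ : ℂ} (hf : HasResidueAtZero f r)
    (hτ : τ ≠ 0) : HasResidueAtZero (fun z => f (z / τ)) (τ * r) := by
  obtain ⟨a, ha, h0, hf⟩ := hf
  refine ⟨fun z => τ * a (z / τ), ?_, by simp [h0], ?_⟩
  · refine analyticAt_const.mul (AnalyticAt.fun_comp (g := a) (f := fun z => z / τ) ?_ ?_)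
    · simpa using ha
    · exact analyticAt_id.div analyticAt_const hτ
  · have ht : Tendsto (fun z : ℂ => z / τ) (𝓝[≠] 0) (𝓝[≠] 0) := by
      refine tendsto_nhdsWithin_iff.2 ⟨?_, ?_⟩
      · exact ((continuous_id.div_const τ).tendsto' 0 0 (by simp)).mono_left nhdsWithin_le_nhds
      · filter_upwards [self_mem_nhdsWithin] with x hx
        exact div_ne_zero hx hτ
    filter_upwards [ht.eventually hf, self_mem_nhdsWithin] with z hz hne
    rw [hz]
    have : z ≠ 0 := hne
    field_simp

/-! ### The vanishing principle off the lattice -/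

theorem dense_offLattice (τ : ℂ) : Dense {z | OffLattice τ z} := by
  have hc : (Set.range fun p : ℤ × ℤ => (p.1 * τ + p.2 : ℂ)).Countable :=
    Set.countable_range _
  refine (hc.dense_compl ℂ).mono ?_
  intro z hz m n h
  exact hz ⟨(m, n), h.symm⟩

theorem OffLattice.add {τ z w : ℂ} (h : OffLattice τ z) (m n : ℤ) (hw : w = z + (m * τ + n)) :
    OffLattice τ w := by
  intro a b hab
  refine h (a - m) (b - n) ?_
  push_cast
  linear_combination hab - hw

theorem OffLattice.neg {τ z : ℂ} (h : OffLattice τ z) : OffLattice τ (-z) := by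
  intro a b hab
  refine h (-a) (-b) ?_
  push_cast
  linear_combination -hab

theorem eq_zero_of_odd_quasiperiodic_off_lattice {D : ℂ → ℂ} {τ k : ℂ} (hk : k ≠ 0)
    (hD : ∀ z, OffLattice τ z → AnalyticAt ℂ D z) (h0 : HasResidueAtZero D 0)
    (h1 : ∀ z, D (z + 1) = D z)
    (hτ : ∀ z, D (z + τ) = k * exp (-(2 * π * I * z)) * D z)
    (hodd : ∀ z, OffLattice τ z → D (-z) = -D z) {z : ℂ} (hz : OffLattice τ z) : D z = 0 := by
  -- A removable singularity at p is transported to p + w by a relation D(z) = u(z) D(z - w) with u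
  -- entire. Starting from 0, this reaches every lattice point.
  have shift : ∀ (p w : ℂ) (u : ℂ → ℂ), Differentiable ℂ u → (∀ z, D z = u z * D (z - w)) →
      (∃ g : ℂ → ℂ, AnalyticAt ℂ g p ∧ D =ᶠ[𝓝[≠] p] g) →
      ∃ g : ℂ → ℂ, AnalyticAt ℂ g (p + w) ∧ D =ᶠ[𝓝[≠] (p + w)] g := by
    rintro p w u hu hDu ⟨g, hg, hDg⟩
    refine ⟨fun z => u z * g (z - w), (hu.analyticAt _).mul ?_, ?_⟩
    · refine AnalyticAt.fun_comp (g := g) (f := fun z => z - w) ?_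
        (analyticAt_id.sub analyticAt_const)
      simpa using hg
    · have ht : Tendsto (fun z : ℂ => z - w) (𝓝[≠] (p + w)) (𝓝[≠] p) := by
        refine tendsto_nhdsWithin_iff.2 ⟨?_, ?_⟩
        · exact ((continuous_id.sub continuous_const).tendsto' _ _ (by simp)).mono_left
            nhdsWithin_le_nhds
        · filter_upwards [self_mem_nhdsWithin] with x hx h
          exact hx (by rw [Set.mem_singleton_iff] at h ⊢; rw [← h]; ring)
      filter_upwards [ht.eventually hDg] with z hz
      rw [hDu, hz]
  have rem : ∀ m n : ℤ, ∃ g : ℂ → ℂ, AnalyticAt ℂ g (m * τ + n) ∧ D =ᶠ[𝓝[≠] (m * τ + n)] g := by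
    intro m n
    have hm : ∃ g : ℂ → ℂ, AnalyticAt ℂ g (m * τ) ∧ D =ᶠ[𝓝[≠] (m * τ)] g := by
      induction m using Int.induction_on with
      | zero => simpa using h0.removable
      | succ i ih =>
        have := shift _ τ (fun z => k * exp (-(2 * π * I * (z - τ)))) (by fun_prop)
          (fun z => by rw [← hτ, sub_add_cancel]) ih
        rwa [show (i : ℤ) * τ + τ = ((i + 1 : ℤ) : ℂ) * τ by push_cast; ring] at this
      | pred i ih =>
        have := shift _ (-τ) (fun z => k⁻¹ * exp (2 * π * I * z)) (by fun_prop)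
          (fun z => by
            rw [sub_neg_eq_add, hτ, exp_neg]
            field_simp [exp_ne_zero]) ih
        rwa [show ((-i : ℤ) : ℂ) * τ + -τ = ((-i - 1 : ℤ) : ℂ) * τ by push_cast; ring] at this
    have h1' : Function.Periodic D 1 := h1
    exact shift _ n (fun _ => 1) (by fun_prop)
      (fun z => by rw [one_mul]; simpa using (h1'.sub_int_mul_eq n).symm) hm
  obtain ⟨N, hN, hND⟩ := exists_entire_of_removable (D := D) (by
    intro p
    by_cases hp : OffLattice τ p
    · exact ⟨D, hD p hp, EventuallyEq.rfl⟩
    · simp only [OffLattice, not_forall, not_not] at hp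
      obtain ⟨m, n, rfl⟩ := hp
      exact rem m n)
  have hoff : ∀ z, OffLattice τ z → N z = D z := fun z hz => hND z (hD z hz).continuousAt
  have hcont := hN.continuous
  have hdense := dense_offLattice τ
  -- The functional equations of D pass to N on the dense complement of the lattice, then everywhere
  -- by continuity.
  have hN0 : N = 0 := by
    refine eq_zero_of_odd_quasiperiodic (τ := τ) hN hk ?_ ?_ ?_
    · refine congrFun (Continuous.ext_on (f := fun z => N (z + 1)) (g := N) hdense
        (by fun_prop) (by fun_prop) ?_)
      intro z hz
      have := OffLattice.add hz 0 1 (w := z + 1) (by simp)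
      simp only
      rw [hoff _ this, hoff _ hz, h1]
    · refine congrFun (Continuous.ext_on (f := fun z => N (z + τ))
        (g := fun z => k * exp (-(2 * π * I * z)) * N z) hdense
        (by fun_prop) (by fun_prop) ?_)
      intro z hz
      have := OffLattice.add hz 1 0 (w := z + τ) (by simp)
      simp only
      rw [hoff _ this, hoff _ hz, hτ]
    · refine congrFun (Continuous.ext_on (f := fun z => N (-z)) (g := fun z => -N z) hdense
        (by fun_prop) (by fun_prop) ?_)
      intro z hz
      simp only
      rw [hoff _ (OffLattice.neg hz), hoff _ hz, hodd z hz]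
  rw [← hoff z hz, hN0, Pi.zero_apply]

/-! ### The Appell–Lerch sum with a shifted numerator -/

/-- The summand of `lerchSum`. -/
noncomputable def lerchTerm (τ c z : ℂ) (j : ℤ) : ℂ :=
  jacobiTheta₂_term j (z + c) τ / (1 - exp (2 * π * I * (z + j * τ)))

/-- `∑_j e(j (z + c)) q^{j² / 2} / (1 - e(z) q^j)`, where `e(w) = exp (2 π i w)`. -/
noncomputable def lerchSum (τ c z : ℂ) : ℂ := ∑' j : ℤ, lerchTerm τ c z j

theorem exp_two_pi_I_mul_add_int (w : ℂ) (n : ℤ) :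
    exp (2 * π * I * (w + n)) = exp (2 * π * I * w) := by
  rw [show 2 * π * I * (w + n) = 2 * π * I * w + n * (2 * π * I) by ring, exp_add,
    exp_int_mul_two_pi_mul_I, mul_one]

theorem one_sub_exp_ne_zero_of_offLattice {τ z : ℂ} (h : OffLattice τ z) (j : ℤ) :
    1 - exp (2 * π * I * (z + j * τ)) ≠ 0 := by
  rw [sub_ne_zero]
  intro he
  obtain ⟨n, hn⟩ := exp_eq_one_iff.1 he.symm
  refine h (-j) n ?_
  have h2 : z + j * τ = n := by
    refine mul_left_cancel₀ two_pi_I_ne_zero ?_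
    linear_combination hn
  push_cast
  linear_combination h2

theorem one_sub_exp_mul_ne_zero {τ : ℂ} (hτ : 0 < τ.im) {j : ℤ} (hj : j ≠ 0) :
    1 - exp (2 * π * I * (0 + j * τ)) ≠ 0 := by
  rw [sub_ne_zero]
  intro he
  obtain ⟨n, hn⟩ := exp_eq_one_iff.1 he.symm
  have h2 : j * τ = n := by
    refine mul_left_cancel₀ two_pi_I_ne_zero ?_
    linear_combination hn
  have := congrArg im h2
  simp [hτ.ne', hj] at this

/-- Since |e(w)| = exp(-2π Im w), it is at most 1/2 or at least 2 once |Im w| ≥ 1. -/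
theorem half_le_norm_one_sub_exp {w : ℂ} (hw : 1 ≤ |w.im|) :
    1 / 2 ≤ ‖1 - exp (2 * π * I * w)‖ := by
  have hn : ‖exp (2 * π * I * w)‖ = Real.exp (-(2 * π * w.im)) := by
    rw [norm_exp]
    congr 1
    simp
  have hpi := Real.pi_gt_three
  rcases le_abs.1 hw with h | h
  · have h1 : ‖exp (2 * π * I * w)‖ ≤ 1 / 2 := by
      rw [hn, Real.exp_neg, one_div]
      refine inv_anti₀ two_pos ?_
      nlinarith [Real.add_one_le_exp (2 * π * w.im)]
    have := norm_sub_norm_le (1 : ℂ) (exp (2 * π * I * w))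
    rw [norm_one] at this
    linarith
  · have h1 : 2 ≤ ‖exp (2 * π * I * w)‖ := by
      rw [hn]
      nlinarith [Real.add_one_le_exp (-(2 * π * w.im))]
    have := norm_sub_norm_le (exp (2 * π * I * w)) 1
    rw [norm_one, norm_sub_rev] at this
    linarith

theorem differentiable_jacobiTheta₂_term (τ c : ℂ) (j : ℤ) :
    Differentiable ℂ fun z => jacobiTheta₂_term j (z + c) τ := by
  unfold jacobiTheta₂_term
  fun_prop

theorem analyticAt_lerchTerm {τ c p : ℂ} {j : ℤ} (h : 1 - exp (2 * π * I * (p + j * τ)) ≠ 0) :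
    AnalyticAt ℂ (fun z => lerchTerm τ c z j) p := by
  refine ((differentiable_jacobiTheta₂_term τ c j).analyticAt p).div ?_ h
  exact Differentiable.analyticAt (f := fun z => 1 - exp (2 * π * I * (z + j * τ)))
    (by fun_prop) p

/-- Near any point, all but finitely many terms of `lerchSum` add up to an analytic function. -/
theorem lerchSum_eventually_eq {τ : ℂ} (hτ : 0 < τ.im) (c p : ℂ) :
    ∃ s : Finset ℤ, 0 ∈ s ∧ ∃ R : ℂ → ℂ, AnalyticAt ℂ R p ∧ ∀ᶠ z in 𝓝 p,
      Summable (lerchTerm τ c z) ∧ lerchSum τ c z = ∑ j ∈ s, lerchTerm τ c z j + R z := by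
  -- For |j| > J and z within 1 of p, Im(z + jτ) has absolute value at least (|Im p| + 2) - |Im p| -
  -- 1 = 1, so the denominators stay away from 0 and the theta bound dominates the tail.
  obtain ⟨J, hJ⟩ := exists_nat_ge ((|p.im| + 2) / τ.im)
  rw [div_le_iff₀ hτ] at hJ
  set s : Finset ℤ := Finset.Icc (-J) J with hs
  set u : ℤ → ℝ := fun j => Real.exp (-π * (τ.im * j ^ 2 - 2 * (|p.im| + |c.im| + 1) * |j|))
    with hu
  have hus : Summable u := by
    simpa [hu] using summable_pow_mul_jacobiTheta₂_term_bound (|p.im| + |c.im| + 1) hτ 0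
  have hmem : ∀ j : {j // j ∉ s}, ∀ z ∈ Metric.ball p 1, 1 ≤ |(z + (j : ℤ) * τ).im| := by
    rintro ⟨j, hj⟩ z hz
    have him : |z.im - p.im| < 1 := by
      rw [mem_ball_iff_norm] at hz
      exact lt_of_le_of_lt (by simpa using abs_im_le_norm (z - p)) hz
    rw [hs, Finset.mem_Icc, ← abs_le, not_le] at hj
    have hj' : (J : ℝ) ≤ |(j : ℝ)| := by exact_mod_cast hj.le
    have h1 : |p.im| + 2 ≤ |(j : ℝ) * τ.im| := by
      rw [abs_mul, abs_of_pos hτ]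
      nlinarith
    have e : (z + (j : ℤ) * τ).im = j * τ.im + p.im + (z.im - p.im) := by
      simp; ring
    rw [e]
    have h2 := abs_add_le ((j : ℝ) * τ.im + p.im + (z.im - p.im)) (-(p.im + (z.im - p.im)))
    have h3 := abs_add_le p.im (z.im - p.im)
    rw [abs_neg] at h2
    rw [show (j : ℝ) * τ.im + p.im + (z.im - p.im) + -(p.im + (z.im - p.im)) = j * τ.im by ring]
      at h2
    linarith
  have hbound : ∀ (j : {j // j ∉ s}) (z : ℂ), z ∈ Metric.ball p 1 →
      ‖lerchTerm τ c z j‖ ≤ 2 * u j := by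
    intro j z hz
    have h1 := half_le_norm_one_sub_exp (hmem j z hz)
    have him : |(z + c).im| ≤ |p.im| + |c.im| + 1 := by
      have h4 : |z.im - p.im| < 1 := by
        rw [mem_ball_iff_norm] at hz
        exact lt_of_le_of_lt (by simpa using abs_im_le_norm (z - p)) hz
      rw [add_im]
      have h2 := abs_add_le z.im c.im
      have h3 := abs_add_le p.im (z.im - p.im)
      rw [add_sub_cancel] at h3
      linarith
    have h2 := norm_jacobiTheta₂_term_le hτ him le_rfl (j : ℤ)
    rw [lerchTerm, norm_div, div_le_iff₀ (by linarith)]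
    have h3 : 0 ≤ u j := (Real.exp_pos _).le
    have h5 : ‖jacobiTheta₂_term j (z + c) τ‖ ≤ u j := by simpa [hu] using h2
    nlinarith
  have hsum : Summable fun j : {j // j ∉ s} => 2 * u j :=
    (hus.mul_left 2).subtype _
  refine ⟨s, by simp [hs], fun z => ∑' j : {j // j ∉ s}, lerchTerm τ c z j, ?_, ?_⟩
  · have hd : DifferentiableOn ℂ (fun z => ∑' j : {j // j ∉ s}, lerchTerm τ c z j)
        (Metric.ball p 1) := by
      refine differentiableOn_tsum_of_summable_norm hsum (fun j z hz => ?_) Metric.isOpen_ball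
        hbound
      have h1 := half_le_norm_one_sub_exp (hmem j z hz)
      have h2 : 1 - exp (2 * π * I * (z + (j : ℤ) * τ)) ≠ 0 := by
        rw [← norm_pos_iff]; linarith
      exact (analyticAt_lerchTerm h2).differentiableAt.differentiableWithinAt
    exact hd.analyticAt (Metric.ball_mem_nhds p one_pos)
  · filter_upwards [Metric.ball_mem_nhds p one_pos] with z hz
    have hsm : Summable (lerchTerm τ c z) := by
      rw [← s.summable_compl_iff]
      exact Summable.of_norm_bounded hsum fun j => hbound j z hz
    exact ⟨hsm, (hsm.sum_add_tsum_subtype_compl s).symm⟩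

theorem summable_lerchTerm {τ : ℂ} (hτ : 0 < τ.im) (c z : ℂ) : Summable (lerchTerm τ c z) := by
  obtain ⟨s, -, R, -, h⟩ := lerchSum_eventually_eq hτ c z
  exact h.self_of_nhds.1

theorem analyticAt_lerchSum {τ : ℂ} (hτ : 0 < τ.im) (c : ℂ) {z : ℂ} (hz : OffLattice τ z) :
    AnalyticAt ℂ (lerchSum τ c) z := by
  obtain ⟨s, -, R, hR, h⟩ := lerchSum_eventually_eq hτ c z
  have : AnalyticAt ℂ (fun z => ∑ j ∈ s, lerchTerm τ c z j + R z) z :=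
    (Finset.analyticAt_fun_sum s fun j _ =>
      analyticAt_lerchTerm (one_sub_exp_ne_zero_of_offLattice hz j)).add hR
  exact this.congr (h.mono fun w hw => hw.2.symm)

/-- The numerator at j = 0 is 1 whatever c is. Hence sums with different numerator shifts have the
same residue at 0 and can cancel. -/
theorem hasResidueAtZero_lerchTerm (τ c : ℂ) :
    HasResidueAtZero (fun z => lerchTerm τ c z 0) (-(2 * π * I)⁻¹) := by
  have hd : HasDerivAt (fun z : ℂ => 1 - exp (2 * π * I * z)) (-(2 * π * I)) 0 := by
    have h1 : HasDerivAt (fun z : ℂ => 2 * π * I * z) (2 * π * I) 0 := by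
      simpa using (hasDerivAt_id (0 : ℂ)).const_mul (2 * π * I)
    simpa using h1.cexp.const_sub 1
  have han : AnalyticAt ℂ (fun z : ℂ => 1 - exp (2 * π * I * z)) 0 :=
    Differentiable.analyticAt (by fun_prop) 0
  obtain ⟨p, hp⟩ := han
  have hs := hp.has_fpower_series_dslope_fslope.analyticAt
  have hs0 : dslope (fun z : ℂ => 1 - exp (2 * π * I * z)) 0 0 = -(2 * π * I) := by
    rw [dslope_same, hd.deriv]
  have hne : dslope (fun z : ℂ => 1 - exp (2 * π * I * z)) 0 0 ≠ 0 := by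
    rw [hs0]; exact neg_ne_zero.2 two_pi_I_ne_zero
  refine ⟨fun z => (dslope (fun z : ℂ => 1 - exp (2 * π * I * z)) 0 z)⁻¹, hs.inv hne, ?_, ?_⟩
  · simp only [hs0, inv_neg]
  · filter_upwards [self_mem_nhdsWithin] with z hz
    have hz' : z ≠ 0 := hz
    rw [dslope_of_ne _ hz, slope_def_field, lerchTerm, jacobiTheta₂_term]
    simp
    field_simp

theorem hasResidueAtZero_lerchSum {τ : ℂ} (hτ : 0 < τ.im) (c : ℂ) :
    HasResidueAtZero (lerchSum τ c) (-(2 * π * I)⁻¹) := by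
  obtain ⟨s, hs, R, hR, h⟩ := lerchSum_eventually_eq hτ c 0
  have h2 : AnalyticAt ℂ (fun z => ∑ j ∈ s.erase 0, lerchTerm τ c z j + R z) 0 :=
    (Finset.analyticAt_fun_sum _ fun j hj =>
      analyticAt_lerchTerm (one_sub_exp_mul_ne_zero hτ (Finset.ne_of_mem_erase hj))).add hR
  obtain ⟨a, ha, ha0, hae⟩ :=
    (hasResidueAtZero_lerchTerm τ c).add (HasResidueAtZero.of_analyticAt h2)
  refine ⟨a, ha, by rw [ha0, add_zero], ?_⟩
  filter_upwards [hae, h.filter_mono nhdsWithin_le_nhds] with z h3 h4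
  rw [← h3, h4.2, ← Finset.add_sum_erase s _ hs, add_assoc]

/-! ### Functional equations of the Appell–Lerch sum -/

/-- This and the next equations are termwise up to reindexing, so they also hold at the poles, where
division by zero gives 0. -/
theorem lerchSum_add_one (τ c z : ℂ) : lerchSum τ c (z + 1) = lerchSum τ c z := by
  unfold lerchSum lerchTerm jacobiTheta₂_term
  refine tsum_congr fun j => ?_
  have h := exp_two_pi_I_mul_add_int (z + j * τ) 1
  rw [show 2 * π * I * j * (z + 1 + c) + π * I * j ^ 2 * τ =
      2 * π * I * j * (z + c) + π * I * j ^ 2 * τ + j * (2 * π * I) by ring,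
    exp_add, exp_int_mul_two_pi_mul_I, mul_one, ← h]
  congr 4
  push_cast
  ring

theorem lerchSum_add_tau (τ c z : ℂ) :
    lerchSum τ c (z + τ) = exp (-(2 * π * I * (z + c)) - π * I * τ) * lerchSum τ c z := by
  unfold lerchSum
  rw [← (Equiv.addRight (1 : ℤ)).tsum_eq (lerchTerm τ c z), ← tsum_mul_left]
  refine tsum_congr fun j => ?_
  unfold lerchTerm jacobiTheta₂_term
  rw [← mul_div_assoc, ← exp_add]
  simp only [Equiv.coe_addRight]
  push_cast
  congr 2
  · ring
  · congr 2
    ring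

theorem lerchSum_sub_tau (τ c z : ℂ) :
    lerchSum τ c (z - τ) = exp (2 * π * I * (z + c) - π * I * τ) * lerchSum τ c z := by
  have h := lerchSum_add_tau τ c (z - τ)
  rw [sub_add_cancel] at h
  rw [h, ← mul_assoc, ← exp_add]
  rw [show 2 * π * I * (z + c) - π * I * τ + (-(2 * π * I * (z - τ + c)) - π * I * τ) = 0 by ring,
    exp_zero, one_mul]

theorem lerchSum_add_numerator_one (τ c z : ℂ) : lerchSum τ (c + 1) z = lerchSum τ c z := by
  unfold lerchSum lerchTerm jacobiTheta₂_term
  refine tsum_congr fun j => ?_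
  rw [show 2 * π * I * j * (z + (c + 1)) + π * I * j ^ 2 * τ =
      2 * π * I * j * (z + c) + π * I * j ^ 2 * τ + j * (2 * π * I) by ring,
    exp_add, exp_int_mul_two_pi_mul_I, mul_one]

/-- After j ↦ -j, with x = e(z)q^j, this is 1/(1 - x⁻¹) = 1 - 1/(1 - x); the constant 1 sums to a
theta function. -/
theorem lerchSum_neg {τ : ℂ} (hτ : 0 < τ.im) (c : ℂ) {z : ℂ} (hz : OffLattice τ z) :
    lerchSum τ c (-z) = jacobiTheta₂ (z - c) τ - lerchSum τ (-c) z := by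
  unfold lerchSum
  rw [jacobiTheta₂, ← Summable.tsum_sub ((summable_jacobiTheta₂_term_iff _ _).2 hτ)
    (summable_lerchTerm hτ _ _), ← (Equiv.neg ℤ).tsum_eq]
  refine tsum_congr fun j => ?_
  simp only [Equiv.neg_apply, lerchTerm]
  have h1 := one_sub_exp_ne_zero_of_offLattice hz j
  have e1 : jacobiTheta₂_term (-j) (-z + c) τ = jacobiTheta₂_term j (z - c) τ := by
    unfold jacobiTheta₂_term
    congr 1
    push_cast
    ring
  have e2 : exp (2 * π * I * (-z + (-j : ℤ) * τ)) = (exp (2 * π * I * (z + j * τ)))⁻¹ := by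
    rw [← exp_neg]
    congr 1
    push_cast
    ring
  rw [e1, e2, ← sub_eq_add_neg z c]
  have h2 := exp_ne_zero (2 * π * I * (z + j * τ))
  generalize exp (2 * π * I * (z + j * τ)) = x at *
  have h3 : 1 - x⁻¹ ≠ 0 := by
    intro h
    apply h1
    field_simp at h
    linear_combination -h
  have h4 : x - 1 ≠ 0 := fun h => h1 (by linear_combination -h)
  rw [div_eq_iff h3]
  field_simp
  ring

/-- The left side multiplies each numerator by x = e(z)q^j, and x/(1 - x) = 1/(1 - x) - 1. -/
theorem exp_mul_lerchSum_add_numerator_tau {τ : ℂ} (hτ : 0 < τ.im) (c : ℂ) {z : ℂ}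
    (hz : OffLattice τ z) :
    exp (2 * π * I * z) * lerchSum τ (c + τ) z = lerchSum τ c z - jacobiTheta₂ (z + c) τ := by
  unfold lerchSum
  rw [jacobiTheta₂, ← Summable.tsum_sub (summable_lerchTerm hτ _ _)
    ((summable_jacobiTheta₂_term_iff _ _).2 hτ), ← tsum_mul_left]
  refine tsum_congr fun j => ?_
  have h1 := one_sub_exp_ne_zero_of_offLattice hz j
  have e1 : exp (2 * π * I * z) * jacobiTheta₂_term j (z + (c + τ)) τ =
      jacobiTheta₂_term j (z + c) τ * exp (2 * π * I * (z + j * τ)) := by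
    unfold jacobiTheta₂_term
    rw [← exp_add, ← exp_add]
    congr 1
    ring
  rw [lerchTerm, lerchTerm, ← mul_div_assoc, e1]
  field_simp
  ring

/-! ### Behaviour of the Appell–Lerch sum under inversion -/

theorem ne_zero_of_im_pos {τ : ℂ} (hτ : 0 < τ.im) : τ ≠ 0 := by
  rintro rfl
  simp at hτ

theorem im_neg_one_div_pos {τ : ℂ} (hτ : 0 < τ.im) : 0 < (-1 / τ).im := by
  have h0 := ne_zero_of_im_pos hτ
  rw [neg_div, one_div, neg_im, inv_im, neg_div, neg_neg]
  exact div_pos hτ (normSq_pos.2 h0)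

theorem OffLattice.inversion {τ z : ℂ} (h : OffLattice τ z) (h0 : τ ≠ 0) :
    OffLattice (-1 / τ) (z / τ) := by
  intro m n hmn
  refine h n (-m) ?_
  field_simp at hmn
  push_cast
  linear_combination hmn

theorem jacobiTheta₂_inversion {τ : ℂ} (h0 : τ ≠ 0) (z : ℂ) :
    jacobiTheta₂ (z / τ) (-1 / τ) =
      (-I * τ) ^ (1 / 2 : ℂ) * exp (π * I * z ^ 2 / τ) * jacobiTheta₂ z τ := by
  have hr : (-I * τ) ^ (1 / 2 : ℂ) ≠ 0 := by
    rw [cpow_def_of_ne_zero (by simp [h0])]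
    exact exp_ne_zero _
  rw [jacobiTheta₂_functional_equation z τ,
    show -π * I * z ^ 2 / τ = -(π * I * z ^ 2 / τ) by ring, exp_neg]
  have := exp_ne_zero (π * I * z ^ 2 / τ)
  field_simp

theorem analyticAt_jacobiTheta₂ {τ : ℂ} (hτ : 0 < τ.im) (c z : ℂ) :
    AnalyticAt ℂ (fun z => jacobiTheta₂ (z + c) τ) z :=
  Differentiable.analyticAt (f := fun z => jacobiTheta₂ (z + c) τ) (fun w =>
    (differentiableAt_jacobiTheta₂_fst (w + c) hτ).comp (f := fun z => z + c) w (by fun_prop)) z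

theorem analyticAt_lerchSum_inversion {τ : ℂ} (hτ : 0 < τ.im) (c : ℂ) {z : ℂ}
    (hz : OffLattice τ z) : AnalyticAt ℂ (fun z => lerchSum (-1 / τ) c (z / τ)) z := by
  have h0 := ne_zero_of_im_pos hτ
  exact AnalyticAt.fun_comp (g := lerchSum (-1 / τ) c) (f := fun z => z / τ)
    (analyticAt_lerchSum (im_neg_one_div_pos hτ) c (hz.inversion h0))
    (analyticAt_id.div analyticAt_const h0)

theorem lerchSum_inversion_add_one (τ c z : ℂ) :
    lerchSum (-1 / τ) c ((z + 1) / τ) =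
      exp (2 * π * I * (z / τ + c) + π * I / τ) * lerchSum (-1 / τ) c (z / τ) := by
  rw [show (z + 1) / τ = z / τ - -1 / τ by ring, lerchSum_sub_tau]
  congr 2
  ring

theorem lerchSum_inversion_add_tau {τ : ℂ} (h0 : τ ≠ 0) (c z : ℂ) :
    lerchSum (-1 / τ) c ((z + τ) / τ) = lerchSum (-1 / τ) c (z / τ) := by
  rw [add_div, div_self h0, lerchSum_add_one]

/-- The difference of the inverted and the original Appell–Lerch sum, corrected by a multiple of a
theta function, vanishes as soon as it is quasi-periodic and odd. -/
theorem lerchSum_inversion_eq_of_odd {τ b c d κ k : ℂ} (hτ : 0 < τ.im) (hk : k ≠ 0)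
    {D : ℂ → ℂ} (hD : D = fun z =>
      exp (-(π * I * z ^ 2 / τ) + b * z) * lerchSum (-1 / τ) c (z / τ) +
        (-τ * lerchSum τ d z + κ * jacobiTheta₂ (z + d) τ))
    (h1 : ∀ z, D (z + 1) = D z) (h2 : ∀ z, D (z + τ) = k * exp (-(2 * π * I * z)) * D z)
    (hodd : ∀ z, OffLattice τ z → D (-z) = -D z) {z : ℂ} (hz : OffLattice τ z) : D z = 0 := by
  have h0 := ne_zero_of_im_pos hτ
  have hexp : Differentiable ℂ fun z => exp (-(π * I * z ^ 2 / τ) + b * z) := by fun_prop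
  refine eq_zero_of_odd_quasiperiodic_off_lattice hk ?_ ?_ h1 h2 hodd hz
  · intro w hw
    rw [hD]
    exact ((hexp.analyticAt w).mul (analyticAt_lerchSum_inversion hτ c hw)).add
      ((analyticAt_const.mul (analyticAt_lerchSum hτ d hw)).add
        (analyticAt_const.mul (analyticAt_jacobiTheta₂ hτ d w)))
  · rw [hD]
    have r1 := ((hasResidueAtZero_lerchSum (im_neg_one_div_pos hτ) c).comp_div h0).mul_left
      (hexp.analyticAt 0)
    have r2 := (hasResidueAtZero_lerchSum hτ d).mul_left (g := fun _ => -τ) analyticAt_const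
    have r3 := HasResidueAtZero.of_analyticAt
      ((analyticAt_const (v := κ)).mul (analyticAt_jacobiTheta₂ hτ d 0))
    have := r1.add (r2.add r3)
    -- The substitution z/τ multiplies the residue by τ, which cancels against the coefficient -τ.
    rwa [show exp (-(π * I * 0 ^ 2 / τ) + b * 0) * (τ * -(2 * π * I)⁻¹) +
      (-τ * -(2 * π * I)⁻¹ + 0) = 0 by simp] at this

theorem lerchSum_zero_inversion {τ z : ℂ} (hτ : 0 < τ.im) (hz : OffLattice τ z) :
    lerchSum (-1 / τ) 0 (z / τ) = exp (π * I * z ^ 2 / τ) *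
      (τ * lerchSum τ 0 z - 1 / 2 * τ * jacobiTheta₂ z τ +
        1 / 2 * (-I * τ) ^ (1 / 2 : ℂ) * jacobiTheta₂ z τ) := by
  have h0 := ne_zero_of_im_pos hτ
  have hE : ∀ z, exp (-(π * I * z ^ 2 / τ) + 0 * z) = (exp (π * I * z ^ 2 / τ))⁻¹ := by
    intro z
    rw [zero_mul, add_zero, exp_neg]
  set r := (-I * τ) ^ (1 / 2 : ℂ) with hr
  -- Without its theta term, D(z) + D(-z) would be (r - τ)ϑ, one theta from reflecting each sum;
  -- this forces κ. The constant k is the multiplier of theta.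
  have key := lerchSum_inversion_eq_of_odd (b := 0) (c := 0) (d := 0) (κ := (τ - r) / 2)
    (k := exp (-(π * I * τ))) hτ (exp_ne_zero _) rfl ?_ ?_ ?_ hz
  · simp only [add_zero, hE] at key
    have hne := exp_ne_zero (π * I * z ^ 2 / τ)
    generalize exp (π * I * z ^ 2 / τ) = E at *
    generalize lerchSum (-1 / τ) 0 (z / τ) = A at *
    have h3 : E * (E⁻¹ * A) = A := by
      rw [← mul_assoc, mul_inv_cancel₀ hne, one_mul]
    linear_combination E * key - h3
  · intro w
    simp only [add_zero, lerchSum_inversion_add_one, lerchSum_add_one, jacobiTheta₂_add_left]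
    rw [← mul_assoc, ← exp_add]
    congr 3
    field_simp
    ring
  · intro w
    simp only [add_zero, lerchSum_inversion_add_tau h0, lerchSum_add_tau, jacobiTheta₂_add_left']
    have e1 : exp (-(π * I * (w + τ) ^ 2 / τ) + 0 * (w + τ)) =
        exp (-(π * I * τ)) * exp (-(2 * π * I * w)) * exp (-(π * I * w ^ 2 / τ) + 0 * w) := by
      rw [← exp_add, ← exp_add]
      congr 1
      field_simp
      ring
    have e2 : exp (-(2 * π * I * w) - π * I * τ) =
        exp (-(π * I * τ)) * exp (-(2 * π * I * w)) := by
      rw [← exp_add]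
      congr 1
      ring
    have e3 : exp (-π * I * (τ + 2 * w)) = exp (-(π * I * τ)) * exp (-(2 * π * I * w)) := by
      rw [← exp_add]
      congr 1
      ring
    rw [e1, e2, e3]
    ring
  · intro w hw
    have hw' := hw.inversion h0
    have hT := jacobiTheta₂_inversion h0 w
    rw [← hr] at hT
    have hne := exp_ne_zero (π * I * w ^ 2 / τ)
    simp only [hE]
    simp only [add_zero, lerchSum_neg hτ 0 hw, jacobiTheta₂_neg_left, neg_sq, neg_zero, sub_zero]
    rw [show -w / τ = -(w / τ) from neg_div _ _, lerchSum_neg (im_neg_one_div_pos hτ) 0 hw', neg_zero, sub_zero, hT]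
    field_simp
    ring

theorem lerchSum_half_inversion {τ z : ℂ} (hτ : 0 < τ.im) (hz : OffLattice τ z) :
    exp (-(π * I * (z / τ))) * lerchSum (-1 / τ) (-(-1 / τ) / 2) (z / τ) =
      exp (π * I * z ^ 2 / τ) *
        (τ * lerchSum τ (1 / 2) z - 1 / 2 * τ * jacobiTheta₂ (z + 1 / 2) τ) +
      (-I * τ) ^ (1 / 2 : ℂ) * exp (π * I / τ * (z ^ 2 + 1 / 4)) *
        jacobiTheta₂ (z + 1 / 2) τ := by
  have h0 := ne_zero_of_im_pos hτ
  have hE : ∀ z, exp (-(π * I * z ^ 2 / τ) + -(π * I / τ) * z) =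
      (exp (π * I * z ^ 2 / τ))⁻¹ * (exp (π * I * z / τ))⁻¹ := by
    intro z
    rw [exp_add, exp_neg, ← exp_neg (π * I * z / τ)]
    congr 2
    ring
  have hc : -(-1 / τ) / 2 = 1 / (2 * τ) := by
    field_simp
  set r := (-I * τ) ^ (1 / 2 : ℂ) with hr
  rw [hc]
  -- Here the inverted side yields two equal theta terms, one by reflection and one by shifting the
  -- numerator from -c back to c, so r enters κ without the factor 1/2.
  have key := lerchSum_inversion_eq_of_odd (b := -(π * I / τ)) (c := 1 / (2 * τ)) (d := 1 / 2)
    (κ := τ / 2 - r * exp (π * I / (4 * τ)))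
    (k := exp (-(π * I * τ) - π * I)) hτ (exp_ne_zero _) rfl ?_ ?_ ?_ hz
  · simp only [hE] at key
    have e1 : exp (π * I / τ * (z ^ 2 + 1 / 4)) =
        exp (π * I * z ^ 2 / τ) * exp (π * I / (4 * τ)) := by
      rw [← exp_add]
      congr 1
      field_simp
    have e2 : exp (-(π * I * (z / τ))) = (exp (π * I * z / τ))⁻¹ := by
      rw [← exp_neg]
      congr 1
      ring
    rw [e1, e2]
    have hne := exp_ne_zero (π * I * z ^ 2 / τ)
    have hne' := exp_ne_zero (π * I * z / τ)
    generalize exp (π * I * z ^ 2 / τ) = E at *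
    generalize exp (π * I * z / τ) = F at *
    generalize lerchSum (-1 / τ) (1 / (2 * τ)) (z / τ) = A at *
    have h3 : E * (E⁻¹ * F⁻¹ * A) = F⁻¹ * A := by
      rw [← mul_assoc, ← mul_assoc, mul_inv_cancel₀ hne, one_mul]
    linear_combination E * key - h3
  · intro w
    simp only [lerchSum_inversion_add_one, lerchSum_add_one, add_right_comm w 1 (1 / 2),
      jacobiTheta₂_add_left]
    rw [← mul_assoc, ← exp_add]
    congr 3
    field_simp
    ring
  · intro w
    simp only [lerchSum_inversion_add_tau h0, lerchSum_add_tau, add_right_comm w τ (1 / 2),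
      jacobiTheta₂_add_left']
    have e1 : exp (-(π * I * (w + τ) ^ 2 / τ) + -(π * I / τ) * (w + τ)) =
        exp (-(π * I * τ) - π * I) * exp (-(2 * π * I * w)) *
          exp (-(π * I * w ^ 2 / τ) + -(π * I / τ) * w) := by
      rw [← exp_add, ← exp_add]
      congr 1
      field_simp
      ring
    have e2 : exp (-(2 * π * I * (w + 1 / 2)) - π * I * τ) =
        exp (-(π * I * τ) - π * I) * exp (-(2 * π * I * w)) := by
      rw [← exp_add]
      congr 1
      ring
    have e3 : exp (-π * I * (τ + 2 * (w + 1 / 2))) =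
        exp (-(π * I * τ) - π * I) * exp (-(2 * π * I * w)) := by
      rw [← exp_add]
      congr 1
      ring
    rw [e1, e2, e3]
    ring
  · intro w hw
    have hw' := hw.inversion h0
    have hτ' := im_neg_one_div_pos hτ
    have t1 : jacobiTheta₂ (w - 1 / 2) τ = jacobiTheta₂ (w + 1 / 2) τ := by
      rw [← jacobiTheta₂_add_left]
      congr 1
      ring
    have t2 : jacobiTheta₂ (-w + 1 / 2) τ = jacobiTheta₂ (w + 1 / 2) τ := by
      rw [← t1, ← jacobiTheta₂_neg_left]
      congr 1
      ring
    have t3 : lerchSum τ (-(1 / 2)) w = lerchSum τ (1 / 2) w := by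
      rw [← lerchSum_add_numerator_one]
      congr 1
      ring
    have s1 := jacobiTheta₂_inversion h0 (w - 1 / 2)
    have s2 := jacobiTheta₂_inversion h0 (w + 1 / 2)
    have m1 := lerchSum_neg hτ' (1 / (2 * τ)) hw'
    have m2 := exp_mul_lerchSum_add_numerator_tau hτ' (1 / (2 * τ)) hw'
    have a1 : w / τ - 1 / (2 * τ) = (w - 1 / 2) / τ := by field_simp
    have a2 : w / τ + 1 / (2 * τ) = (w + 1 / 2) / τ := by field_simp
    -- For the period -1/τ the shift c = 1/(2τ) is minus half a period, so -c is c plus one period.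
    have a3 : 1 / (2 * τ) + -1 / τ = -(1 / (2 * τ)) := by field_simp; ring
    have x1 : exp (π * I * (w - 1 / 2) ^ 2 / τ) = exp (π * I * w ^ 2 / τ) *
        (exp (π * I * w / τ))⁻¹ * exp (π * I / (4 * τ)) := by
      rw [← exp_neg, ← exp_add, ← exp_add]
      congr 1
      field_simp
      ring
    have x2 : exp (π * I * (w + 1 / 2) ^ 2 / τ) = exp (π * I * w ^ 2 / τ) *
        exp (π * I * w / τ) * exp (π * I / (4 * τ)) := by
      rw [← exp_add, ← exp_add]
      congr 1
      field_simp
      ring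
    have x3 : exp (2 * π * I * (w / τ)) = exp (π * I * w / τ) * exp (π * I * w / τ) := by
      rw [← exp_add]
      congr 1
      ring
    have x4 : (exp (π * I * -w / τ))⁻¹ = exp (π * I * w / τ) := by
      rw [← exp_neg]
      congr 1
      ring
    rw [a1, s1, t1, x1, ← hr] at m1
    rw [a2, a3, s2, x2, x3, ← hr] at m2
    simp only [hE]
    simp only [neg_sq, lerchSum_neg hτ _ hw, t1, t2, t3, x4]
    rw [show -w / τ = -(w / τ) from neg_div _ _, m1]
    have hne := exp_ne_zero (π * I * w ^ 2 / τ)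
    have hne' := exp_ne_zero (π * I * w / τ)
    generalize exp (π * I * w ^ 2 / τ) = E at *
    generalize exp (π * I * w / τ) = F at *
    have m3 : lerchSum (-1 / τ) (1 / (2 * τ)) (w / τ) =
        F * F * lerchSum (-1 / τ) (-(1 / (2 * τ))) (w / τ) +
        r * (E * F * exp (π * I / (4 * τ))) * jacobiTheta₂ (w + 1 / 2) τ := by
      linear_combination -m2
    rw [m3]
    field_simp
    ring

theorem lerchSum_numerator_tau_inversion {τ z : ℂ} (hτ : 0 < τ.im) (hz : OffLattice τ z) :
    lerchSum (-1 / τ) (1 / 2) (z / τ) = exp (π * I * z ^ 2 / τ) *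
      (τ * (exp (-(π * I * z)) * lerchSum τ (-τ / 2) z) -
        τ * (exp (π * I * z) * jacobiTheta₂ (z + τ / 2) τ) +
        1 / 2 * (-I * τ) ^ (1 / 2 : ℂ) *
          (exp (π * I * τ / 4 + π * I * z) * jacobiTheta₂ (z + τ / 2) τ)) := by
  have h0 := ne_zero_of_im_pos hτ
  have hτ' := im_neg_one_div_pos hτ
  have h0' := ne_zero_of_im_pos hτ'
  have hinv : -1 / (-1 / τ) = τ := by field_simp
  have hu : z / τ / (-1 / τ) = -z := by field_simp
  have hS := lerchSum_half_inversion hτ' (hz.inversion h0)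
  have hT := jacobiTheta₂_inversion h0' (z / τ + 1 / 2)
  have hT2 := jacobiTheta₂_inversion h0 (z + τ / 2)
  rw [hinv, hu] at hS
  rw [hinv, show (z / τ + 1 / 2) / (-1 / τ) = -(z + τ / 2) by field_simp,
    jacobiTheta₂_neg_left] at hT
  rw [show (z + τ / 2) / τ = z / τ + 1 / 2 by field_simp] at hT2
  have hN := lerchSum_neg hτ (-τ / 2) hz
  have hM := exp_mul_lerchSum_add_numerator_tau hτ (-τ / 2) hz
  rw [show -τ / 2 + τ = τ / 2 by ring] at hM
  rw [show -(-τ / 2) = τ / 2 by ring, show z - -τ / 2 = z + τ / 2 by ring] at hN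
  have hP := jacobiTheta₂_add_left' (z + -τ / 2) τ
  rw [show z + -τ / 2 + τ = z + τ / 2 by ring] at hP
  have x1 : exp (-π * I * (τ + 2 * (z + -τ / 2))) = exp (-(π * I * z)) * exp (-(π * I * z)) := by
    rw [← exp_add]
    congr 1
    ring
  have x2 : exp (2 * π * I * z) = exp (π * I * z) * exp (π * I * z) := by
    rw [← exp_add]
    congr 1
    ring
  have x3 : exp (π * I * (z / τ) ^ 2 / (-1 / τ)) = exp (-(π * I * z ^ 2 / τ)) := by
    congr 1
    field_simp
  have x4 : exp (π * I / (-1 / τ) * ((z / τ) ^ 2 + 1 / 4)) =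
      exp (π * I * (z / τ + 1 / 2) ^ 2 / (-1 / τ)) * exp (π * I * z) := by
    rw [← exp_add]
    congr 1
    field_simp
    ring
  have x5 : exp (π * I * (z + τ / 2) ^ 2 / τ) =
      exp (π * I * z ^ 2 / τ) * exp (π * I * τ / 4 + π * I * z) := by
    rw [← exp_add]
    congr 1
    field_simp
    ring
  have y1 : exp (π * I * z ^ 2 / τ) * exp (-(π * I * z ^ 2 / τ)) = 1 := by
    rw [← exp_add, add_neg_cancel, exp_zero]
  have y2 : exp (π * I * z) * exp (-(π * I * z)) = 1 := by
    rw [← exp_add, add_neg_cancel, exp_zero]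
  rw [show -(π * I * -z) = π * I * z by ring, hN, x3, x4, hT2, x5] at hS
  rw [hT2, x5] at hT
  rw [x1] at hP
  rw [x2] at hM
  generalize lerchSum (-1 / τ) (1 / 2) (z / τ) = A at *
  generalize lerchSum τ (-τ / 2) z = B at *
  generalize lerchSum τ (τ / 2) z = C at *
  generalize jacobiTheta₂ (z + τ / 2) τ = t at *
  generalize jacobiTheta₂ (z + -τ / 2) τ = t' at *
  generalize exp (π * I * z ^ 2 / τ) = E at *
  generalize exp (-(π * I * z ^ 2 / τ)) = E' at *
  generalize exp (π * I * z) = F at *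
  generalize exp (-(π * I * z)) = F' at *
  generalize exp (π * I * τ / 4 + π * I * z) = X at *
  generalize (-I * τ) ^ (1 / 2 : ℂ) = r at *
  generalize (-I * (-1 / τ)) ^ (1 / 2 : ℂ) = r' at *
  generalize exp (π * I * (z / τ + 1 / 2) ^ 2 / (-1 / τ)) = Y at *
  -- Only algebra remains: `c1` and `c2` pass from the shift τ/2 to -τ/2. In `c3`, Jacobi inversion
  -- absorbs the root `r'` at -1/τ into theta, so no relation between `r` and `r'` is needed.
  have c1 : F * C = F' * B - F' * t' := by linear_combination F' * hM - F * C * y2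
  have c2 : F' * t' = F * t := by
    rw [hP]
    linear_combination -F' * t' * y2
  have c3 : F * (t - C) =
      E' * (-1 / τ * A - 1 / 2 * (-1 / τ) * (r * (E * X) * t)) + F * t := by
    linear_combination hS - F * hT
  have c4 : τ * F * C = E' * (A - 1 / 2 * (r * (E * X) * t)) := by
    have : τ * (F * (t - C)) =
        τ * (E' * (-1 / τ * A - 1 / 2 * (-1 / τ) * (r * (E * X) * t)) + F * t) := by rw [c3]
    field_simp at this
    linear_combination -this / 2
  linear_combination (-E) * c4 + E * τ * c1 - E * τ * c2 - (A - 1 / 2 * (r * (E * X) * t)) * y1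

theorem lerchSum_add_one_left (τ c z : ℂ) :
    lerchSum (τ + 1) c z = lerchSum τ (c + 1 / 2) z := by
  unfold lerchSum lerchTerm jacobiTheta₂_term
  refine tsum_congr fun j => ?_
  have h1 : exp (2 * π * I * (z + j * (τ + 1))) = exp (2 * π * I * (z + j * τ)) := by
    rw [← exp_two_pi_I_mul_add_int (z + j * τ) j]
    congr 1
    ring
  rw [h1]
  congr 1
  -- The factor exp(πij²) produced by τ ↦ τ + 1 equals exp(πij), because j² - j is even; this is a
  -- numerator shift by 1/2.
  obtain ⟨k, hk⟩ := Int.even_mul_pred_self j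
  have hk' : (j : ℂ) * (j - 1) = k + k := by exact_mod_cast hk
  refine exp_eq_exp_iff_exists_int.2 ⟨k, ?_⟩
  linear_combination π * I * hk'

/-! ### The twelve functions as shifted Appell–Lerch sums -/

theorem neg_one_zpow_eq_exp (j : ℤ) : (-1 : ℂ) ^ j = exp (π * I * j) := by
  rw [← exp_pi_mul_I, ← exp_int_mul]
  congr 1
  ring

theorem exp_mul_qPow (τ z s : ℂ) :
    exp (2 * π * I * z) * qPow τ s = exp (2 * π * I * (z + s * τ)) := by
  rw [qPow, ← exp_add]
  congr 1
  ring

theorem exp_two_pi_I_mul_add_half (w : ℂ) :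
    exp (2 * π * I * (w + 1 / 2)) = -exp (2 * π * I * w) := by
  rw [show 2 * π * I * (w + 1 / 2) = 2 * π * I * w + π * I by ring, exp_add, exp_pi_mul_I]
  ring

theorem f1_eq (τ z : ℂ) : f1 τ z = lerchSum τ 0 z := by
  refine tsum_congr fun j => congrArg₂ (· / ·) ?_ ?_
  · rw [qPow, jacobiTheta₂_term, ← exp_add]
    exact exp_eq_exp_iff_exists_int.2 ⟨0, by push_cast; ring⟩
  · rw [exp_mul_qPow]

theorem f2_eq (τ z : ℂ) :
    f2 τ z = exp (π * I * z + π * I * τ / 4) * lerchSum τ 0 (z + (1 + τ) / 2) := by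
  rw [lerchSum, ← tsum_mul_left]
  refine tsum_congr fun j => ?_
  rw [lerchTerm, ← mul_div_assoc]
  refine congrArg₂ (· / ·) ?_ ?_
  · rw [qPow, jacobiTheta₂_term, neg_one_zpow_eq_exp, ← exp_add, ← exp_add, ← exp_add]
    exact exp_eq_exp_iff_exists_int.2 ⟨0, by push_cast; ring⟩
  · rw [exp_mul_qPow, show z + (1 + τ) / 2 + j * τ = z + (j + 1 / 2) * τ + 1 / 2 by ring,
      exp_two_pi_I_mul_add_half, sub_neg_eq_add]

theorem f3_eq (τ z : ℂ) : f3 τ z = lerchSum τ 0 (z + 1 / 2) := by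
  refine tsum_congr fun j => congrArg₂ (· / ·) ?_ ?_
  · rw [qPow, jacobiTheta₂_term, neg_one_zpow_eq_exp, ← exp_add, ← exp_add]
    exact exp_eq_exp_iff_exists_int.2 ⟨0, by push_cast; ring⟩
  · rw [exp_mul_qPow, add_right_comm z, exp_two_pi_I_mul_add_half, sub_neg_eq_add]

theorem f4_eq (τ z : ℂ) :
    f4 τ z = exp (π * I * z + π * I * τ / 4) * lerchSum τ 0 (z + τ / 2) := by
  rw [lerchSum, ← tsum_mul_left]
  refine tsum_congr fun j => ?_
  rw [lerchTerm, ← mul_div_assoc]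
  refine congrArg₂ (· / ·) ?_ ?_
  · rw [qPow, jacobiTheta₂_term, ← exp_add, ← exp_add]
    exact exp_eq_exp_iff_exists_int.2 ⟨0, by push_cast; ring⟩
  · rw [exp_mul_qPow, show z + τ / 2 + j * τ = z + (j + 1 / 2) * τ by ring]

theorem g1_eq (τ z : ℂ) : g1 τ z = exp (-(π * I * z)) * lerchSum τ (-τ / 2) z := by
  rw [lerchSum, ← tsum_mul_left]
  refine tsum_congr fun j => ?_
  rw [lerchTerm, ← mul_div_assoc]
  refine congrArg₂ (· / ·) ?_ ?_
  · rw [qPow, jacobiTheta₂_term, ← exp_add, ← exp_add]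
    exact exp_eq_exp_iff_exists_int.2 ⟨0, by push_cast; ring⟩
  · rw [exp_mul_qPow]

theorem g2_eq (τ z : ℂ) :
    g2 τ z = exp (-(π * I * z)) * lerchSum τ (-τ / 2) (z + 1 / 2) := by
  rw [lerchSum, ← tsum_mul_left]
  refine tsum_congr fun j => ?_
  rw [lerchTerm, ← mul_div_assoc]
  refine congrArg₂ (· / ·) ?_ ?_
  · rw [qPow, jacobiTheta₂_term, neg_one_zpow_eq_exp, ← exp_add, ← exp_add, ← exp_add]
    exact exp_eq_exp_iff_exists_int.2 ⟨0, by push_cast; ring⟩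
  · rw [exp_mul_qPow, add_right_comm z, exp_two_pi_I_mul_add_half, sub_neg_eq_add]

theorem g3_eq (τ z : ℂ) :
    g3 τ z = exp (-(π * I * τ / 4)) * lerchSum τ (-τ / 2) (z + τ / 2) := by
  rw [lerchSum, ← tsum_mul_left]
  refine tsum_congr fun j => ?_
  rw [lerchTerm, ← mul_div_assoc]
  refine congrArg₂ (· / ·) ?_ ?_
  · rw [qPow, jacobiTheta₂_term, ← exp_add, ← exp_add]
    exact exp_eq_exp_iff_exists_int.2 ⟨0, by push_cast; ring⟩
  · rw [exp_mul_qPow, show z + τ / 2 + j * τ = z + (j + 1 / 2) * τ by ring]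

theorem g4_eq (τ z : ℂ) :
    g4 τ z = exp (-(π * I * τ / 4)) * lerchSum τ (-τ / 2) (z + (1 + τ) / 2) := by
  rw [lerchSum, ← tsum_mul_left]
  refine tsum_congr fun j => ?_
  rw [lerchTerm, ← mul_div_assoc]
  refine congrArg₂ (· / ·) ?_ ?_
  · rw [qPow, jacobiTheta₂_term, neg_one_zpow_eq_exp, ← exp_add, ← exp_add, ← exp_add]
    exact exp_eq_exp_iff_exists_int.2 ⟨0, by push_cast; ring⟩
  · rw [exp_mul_qPow, show z + (1 + τ) / 2 + j * τ = z + (j + 1 / 2) * τ + 1 / 2 by ring,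
      exp_two_pi_I_mul_add_half, sub_neg_eq_add]

theorem h1_eq (τ z : ℂ) : h1 τ z = lerchSum τ (1 / 2) z := by
  refine tsum_congr fun j => congrArg₂ (· / ·) ?_ ?_
  · rw [qPow, jacobiTheta₂_term, neg_one_zpow_eq_exp, ← exp_add, ← exp_add]
    exact exp_eq_exp_iff_exists_int.2 ⟨0, by push_cast; ring⟩
  · rw [exp_mul_qPow]

theorem h2_eq (τ z : ℂ) :
    h2 τ z = exp (π * I * z + π * I * τ / 4) * lerchSum τ (1 / 2) (z + τ / 2) := by
  rw [lerchSum, ← tsum_mul_left]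
  refine tsum_congr fun j => ?_
  rw [lerchTerm, ← mul_div_assoc]
  refine congrArg₂ (· / ·) ?_ ?_
  · rw [qPow, jacobiTheta₂_term, neg_one_zpow_eq_exp, ← exp_add, ← exp_add, ← exp_add]
    exact exp_eq_exp_iff_exists_int.2 ⟨0, by push_cast; ring⟩
  · rw [exp_mul_qPow, show z + τ / 2 + j * τ = z + (j + 1 / 2) * τ by ring]

theorem h3_eq (τ z : ℂ) : h3 τ z = lerchSum τ (1 / 2) (z + 1 / 2) := by
  refine tsum_congr fun j => congrArg₂ (· / ·) ?_ ?_
  · rw [qPow, jacobiTheta₂_term, ← exp_add]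
    -- The signs from c = 1/2 and from z + 1/2 combine to e(j) = 1, whence the witness -j.
    exact exp_eq_exp_iff_exists_int.2 ⟨-j, by push_cast; ring⟩
  · rw [exp_mul_qPow, add_right_comm z, exp_two_pi_I_mul_add_half, sub_neg_eq_add]

theorem h4_eq (τ z : ℂ) :
    h4 τ z = exp (π * I * z + π * I * τ / 4) * lerchSum τ (1 / 2) (z + (1 + τ) / 2) := by
  rw [lerchSum, ← tsum_mul_left]
  refine tsum_congr fun j => ?_
  rw [lerchTerm, ← mul_div_assoc]
  refine congrArg₂ (· / ·) ?_ ?_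
  · rw [qPow, jacobiTheta₂_term, ← exp_add, ← exp_add]
    exact exp_eq_exp_iff_exists_int.2 ⟨-j, by push_cast; ring⟩
  · rw [exp_mul_qPow, show z + (1 + τ) / 2 + j * τ = z + (j + 1 / 2) * τ + 1 / 2 by ring,
      exp_two_pi_I_mul_add_half, sub_neg_eq_add]

/-! ### Transformations of the shifted sums -/

theorem exp_pi_I_div_two : exp (π * I / 2) = I := by
  rw [show (π * I / 2 : ℂ) = π / 2 * I by ring, exp_pi_div_two_mul_I]

theorem I_mul_exp (w : ℂ) : I * exp w = exp (w + π * I / 2) := by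
  rw [exp_add, exp_pi_I_div_two, mul_comm]

theorem neg_I_mul_exp (w : ℂ) : -I * exp w = exp (w - π * I / 2) := by
  rw [exp_sub, exp_pi_I_div_two, div_I, mul_comm, mul_neg]

theorem lerchSum_sub_one (τ c z : ℂ) : lerchSum τ c (z - 1) = lerchSum τ c z := by
  rw [← lerchSum_add_one, sub_add_cancel]

theorem jacobiTheta₂_sub_one (τ z : ℂ) : jacobiTheta₂ (z - 1) τ = jacobiTheta₂ z τ := by
  rw [← jacobiTheta₂_add_left, sub_add_cancel]

theorem qPow_mul_theta10 (τ z : ℂ) :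
    qPow τ (-1 / 8) * theta10 τ z = exp (π * I * z) * jacobiTheta₂ (z + τ / 2) τ := by
  rw [qPow, theta10, ← mul_assoc, ← exp_add]
  congr 2
  ring

theorem exp_sq_add_half_tau {τ : ℂ} (h0 : τ ≠ 0) (z : ℂ) :
    exp (π * I * (z + τ / 2) ^ 2 / τ) =
      exp (π * I * z ^ 2 / τ) * exp (π * I * z + π * I * τ / 4) := by
  rw [← exp_add]
  congr 1
  field_simp
  ring

theorem exp_mul_exp_sq_sub_half {τ : ℂ} (h0 : τ ≠ 0) (z : ℂ) :
    exp (π * I * (z / τ) + π * I * (-1 / τ) / 4) * exp (π * I * (z - 1 / 2) ^ 2 / τ) =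
      exp (π * I * z ^ 2 / τ) := by
  rw [← exp_add]
  congr 1
  field_simp
  ring

theorem exp_mul_exp_sq_add_half_sub_one {τ : ℂ} (h0 : τ ≠ 0) (z : ℂ) :
    exp (π * I * (z / τ) + π * I * (-1 / τ) / 4) * exp (π * I * (z + (1 + τ) / 2 - 1) ^ 2 / τ) =
      -I * (exp (π * I * z ^ 2 / τ) * exp (π * I * z + π * I * τ / 4)) := by
  rw [← exp_add, ← exp_add, neg_I_mul_exp]
  congr 1
  field_simp
  ring

theorem theta10_eq (τ z : ℂ) :
    theta10 τ z = exp (π * I * z + π * I * τ / 4) * jacobiTheta₂ (z + τ / 2) τ := by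
  rw [theta10, add_comm (π * I * z)]

theorem theta11_eq (τ z : ℂ) :
    theta11 τ z =
      I * (exp (π * I * z + π * I * τ / 4) * jacobiTheta₂ (z + (1 + τ) / 2) τ) := by
  rw [theta11, ← mul_assoc, I_mul_exp]
  congr 2
  ring

/-- Inversion exchanges the half-periods 1/2 and τ/2 modulo the lattice and fixes (1+τ)/2; this
dictates which of the functions are paired by S. -/
theorem div_add_half {τ : ℂ} (h0 : τ ≠ 0) (z : ℂ) : z / τ + 1 / 2 = (z + τ / 2) / τ := by
  field_simp

theorem div_add_half_inversion (τ z : ℂ) : z / τ + -1 / τ / 2 = (z - 1 / 2) / τ := by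
  ring

theorem div_add_half_add_inversion {τ : ℂ} (h0 : τ ≠ 0) (z : ℂ) :
    z / τ + (1 + -1 / τ) / 2 = (z + (1 + τ) / 2 - 1) / τ := by
  field_simp
  ring

/-! ### S-transformation of the twelve functions. -/

theorem f1_inversion {τ z : ℂ} (hτ : 0 < τ.im)
    (hz : OffLattice τ z) :
    f1 (-1 / τ) (z / τ) = exp (π * I * z ^ 2 / τ) *
      (τ * f1 τ z - 1 / 2 * τ * theta00 τ z + 1 / 2 * (-I * τ) ^ (1 / 2 : ℂ) * theta00 τ z) := by
  rw [f1_eq, f1_eq, lerchSum_zero_inversion hτ hz, theta00]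

theorem f2_inversion {τ z : ℂ} (hτ : 0 < τ.im)
    (hz : OffLattice τ (z - (1 + τ) / 2)) :
    f2 (-1 / τ) (z / τ) = exp (π * I * z ^ 2 / τ) *
      (-I * τ * f2 τ z + 1 / 2 * τ * theta11 τ z -
        1 / 2 * (-I * τ) ^ (1 / 2 : ℂ) * theta11 τ z) := by
  have h0 := ne_zero_of_im_pos hτ
  have hw : OffLattice τ (z + (1 + τ) / 2 - 1) := hz.add 1 0 (by push_cast; ring)
  rw [f2_eq, f2_eq, div_add_half_add_inversion h0, lerchSum_zero_inversion hτ hw, ← mul_assoc,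
    exp_mul_exp_sq_add_half_sub_one h0, lerchSum_sub_one, jacobiTheta₂_sub_one, theta11_eq]
  ring

theorem f3_inversion {τ z : ℂ} (hτ : 0 < τ.im)
    (hz : OffLattice τ (z - τ / 2)) :
    f3 (-1 / τ) (z / τ) = exp (π * I * z ^ 2 / τ) *
      (τ * f4 τ z - 1 / 2 * τ * theta10 τ z + 1 / 2 * (-I * τ) ^ (1 / 2 : ℂ) * theta10 τ z) := by
  have h0 := ne_zero_of_im_pos hτ
  have hw : OffLattice τ (z + τ / 2) := hz.add 1 0 (by push_cast; ring)
  rw [f3_eq, f4_eq, div_add_half h0, lerchSum_zero_inversion hτ hw, exp_sq_add_half_tau h0,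
    theta10_eq]
  ring

theorem f4_inversion {τ z : ℂ} (hτ : 0 < τ.im)
    (hz : OffLattice τ (z - 1 / 2)) :
    f4 (-1 / τ) (z / τ) = exp (π * I * z ^ 2 / τ) *
      (τ * f3 τ z - 1 / 2 * τ * theta01 τ z + 1 / 2 * (-I * τ) ^ (1 / 2 : ℂ) * theta01 τ z) := by
  have h0 := ne_zero_of_im_pos hτ
  rw [f3_eq, f4_eq, div_add_half_inversion, lerchSum_zero_inversion hτ hz, ← mul_assoc,
    exp_mul_exp_sq_sub_half h0, theta01, ← lerchSum_sub_one τ 0 (z + 1 / 2),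
    ← jacobiTheta₂_sub_one τ (z + 1 / 2), show z + 1 / 2 - 1 = z - 1 / 2 by ring]

theorem g1_inversion {τ z : ℂ} (hτ : 0 < τ.im)
    (hz : OffLattice τ z) :
    g1 (-1 / τ) (z / τ) = exp (π * I * z ^ 2 / τ) * (τ * h1 τ z - 1 / 2 * τ * theta01 τ z) +
      (-I * τ) ^ (1 / 2 : ℂ) * exp (π * I / τ * (z ^ 2 + 1 / 4)) * theta01 τ z := by
  rw [g1_eq, h1_eq, lerchSum_half_inversion hτ hz, theta01]

theorem exp_div_mul_sq_add_quarter (τ z : ℂ) : exp (π * I / τ * (z ^ 2 + 1 / 4)) =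
    exp (π * I * z ^ 2 / τ) * exp (π * I / τ * (1 / 4)) := by
  rw [← exp_add]
  congr 1
  ring

/-- The inversion formula of `lerchSum_half_inversion` with the common exponential factored out. -/
theorem lerchSum_half_inversion_factored {τ z : ℂ} (hτ : 0 < τ.im)
    (hz : OffLattice τ z) :
    lerchSum (-1 / τ) (-(-1 / τ) / 2) (z / τ) =
      exp (π * I * (z / τ)) * exp (π * I * z ^ 2 / τ) *
        (τ * lerchSum τ (1 / 2) z - 1 / 2 * τ * jacobiTheta₂ (z + 1 / 2) τ +
          (-I * τ) ^ (1 / 2 : ℂ) * exp (π * I / τ * (1 / 4)) * jacobiTheta₂ (z + 1 / 2) τ) := by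
  have h := lerchSum_half_inversion hτ hz
  have e2 : exp (π * I * (z / τ)) * exp (-(π * I * (z / τ))) = 1 := by
    rw [← exp_add, add_neg_cancel, exp_zero]
  rw [exp_div_mul_sq_add_quarter] at h
  linear_combination exp (π * I * (z / τ)) * h -
    lerchSum (-1 / τ) (-(-1 / τ) / 2) (z / τ) * e2

theorem g2_inversion {τ z : ℂ} (hτ : 0 < τ.im)
    (hz : OffLattice τ (z - τ / 2)) :
    g2 (-1 / τ) (z / τ) = exp (π * I * z ^ 2 / τ) * (I * τ * h2 τ z - 1 / 2 * τ * theta11 τ z) +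
      (-I * τ) ^ (1 / 2 : ℂ) * exp (π * I / τ * (z ^ 2 + 1 / 4)) * theta11 τ z := by
  have h0 := ne_zero_of_im_pos hτ
  have hw : OffLattice τ (z + τ / 2) := hz.add 1 0 (by push_cast; ring)
  have e : exp (-(π * I * (z / τ))) * exp (π * I * ((z + τ / 2) / τ)) = I := by
    rw [← exp_add]
    refine (congrArg exp ?_).trans exp_pi_I_div_two
    field_simp
    ring
  rw [g2_eq, h2_eq, div_add_half h0, lerchSum_half_inversion_factored hτ hw,
    exp_sq_add_half_tau h0, ← mul_assoc, ← mul_assoc, e, theta11_eq, exp_div_mul_sq_add_quarter,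
    show z + τ / 2 + 1 / 2 = z + (1 + τ) / 2 by ring]
  ring

theorem g3_inversion {τ z : ℂ} (hτ : 0 < τ.im)
    (hz : OffLattice τ (z - 1 / 2)) :
    g3 (-1 / τ) (z / τ) = exp (π * I * z ^ 2 / τ) * (τ * h3 τ z - 1 / 2 * τ * theta00 τ z) +
      (-I * τ) ^ (1 / 2 : ℂ) * exp (π * I / τ * (z ^ 2 + 1 / 4)) * theta00 τ z := by
  have h0 := ne_zero_of_im_pos hτ
  have e : exp (-(π * I * (-1 / τ) / 4)) * exp (π * I * ((z - 1 / 2) / τ)) =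
      exp (π * I * (z / τ) + π * I * (-1 / τ) / 4) := by
    rw [← exp_add]
    congr 1
    field_simp
    ring
  rw [g3_eq, h3_eq, div_add_half_inversion, lerchSum_half_inversion_factored hτ hz,
    ← mul_assoc, ← mul_assoc, e, exp_mul_exp_sq_sub_half h0, theta00, exp_div_mul_sq_add_quarter,
    sub_add_cancel, ← lerchSum_sub_one τ (1 / 2) (z + 1 / 2),
    show z + 1 / 2 - 1 = z - 1 / 2 by ring]
  ring

theorem g4_inversion {τ z : ℂ} (hτ : 0 < τ.im)
    (hz : OffLattice τ (z - (1 + τ) / 2)) :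
    g4 (-1 / τ) (z / τ) = exp (π * I * z ^ 2 / τ) * (τ * h4 τ z - 1 / 2 * τ * theta10 τ z) +
      (-I * τ) ^ (1 / 2 : ℂ) * exp (π * I / τ * (z ^ 2 + 1 / 4)) * theta10 τ z := by
  have h0 := ne_zero_of_im_pos hτ
  have hw : OffLattice τ (z + (1 + τ) / 2 - 1) := hz.add 1 0 (by push_cast; ring)
  have e : exp (-(π * I * (-1 / τ) / 4)) * exp (π * I * ((z + (1 + τ) / 2 - 1) / τ)) =
      I * exp (π * I * (z / τ) + π * I * (-1 / τ) / 4) := by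
    rw [← exp_add, I_mul_exp]
    congr 1
    field_simp
    ring
  rw [g4_eq, h4_eq, div_add_half_add_inversion h0, lerchSum_half_inversion_factored hτ hw,
    ← mul_assoc, ← mul_assoc, e, mul_assoc I, exp_mul_exp_sq_add_half_sub_one h0, theta10_eq,
    exp_div_mul_sq_add_quarter, lerchSum_sub_one,
    show z + (1 + τ) / 2 - 1 + 1 / 2 = z + τ / 2 by ring, ← mul_assoc I, mul_neg, I_mul_I]
  ring

theorem h1_inversion {τ z : ℂ} (hτ : 0 < τ.im)
    (hz : OffLattice τ z) :
    h1 (-1 / τ) (z / τ) = exp (π * I * z ^ 2 / τ) *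
      (τ * g1 τ z - τ * qPow τ (-1 / 8) * theta10 τ z +
        1 / 2 * (-I * τ) ^ (1 / 2 : ℂ) * theta10 τ z) := by
  rw [h1_eq, g1_eq, mul_assoc τ (qPow _ _), qPow_mul_theta10,
    lerchSum_numerator_tau_inversion hτ hz, theta10]

theorem h2_inversion {τ z : ℂ} (hτ : 0 < τ.im)
    (hz : OffLattice τ (z - 1 / 2)) :
    h2 (-1 / τ) (z / τ) = exp (π * I * z ^ 2 / τ) *
      (I * τ * g2 τ z + τ * qPow τ (-1 / 8) * theta11 τ z -
        1 / 2 * (-I * τ) ^ (1 / 2 : ℂ) * theta11 τ z) := by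
  have h0 := ne_zero_of_im_pos hτ
  have e1 : exp (-(π * I * (z - 1 / 2))) = I * exp (-(π * I * z)) := by
    rw [I_mul_exp]
    congr 1
    ring
  have e2 : exp (π * I * (z - 1 / 2)) = -I * exp (π * I * z) := by
    rw [neg_I_mul_exp]
    congr 1
    ring
  have e3 : exp (π * I * τ / 4 + π * I * (z - 1 / 2)) =
      -I * exp (π * I * z + π * I * τ / 4) := by
    rw [neg_I_mul_exp]
    congr 1
    ring
  have e4 : qPow τ (-1 / 8) * exp (π * I * z + π * I * τ / 4) = exp (π * I * z) := by
    rw [qPow, ← exp_add]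
    congr 1
    ring
  rw [h2_eq, g2_eq, div_add_half_inversion, lerchSum_numerator_tau_inversion hτ hz, ← mul_assoc,
    exp_mul_exp_sq_sub_half h0, theta11_eq, e1, e2, e3, ← e4,
    ← lerchSum_sub_one τ (-τ / 2) (z + 1 / 2), ← jacobiTheta₂_sub_one τ (z + (1 + τ) / 2),
    show z + 1 / 2 - 1 = z - 1 / 2 by ring, show z + (1 + τ) / 2 - 1 = z - 1 / 2 + τ / 2 by ring]
  ring

theorem h3_inversion {τ z : ℂ} (hτ : 0 < τ.im)
    (hz : OffLattice τ (z - τ / 2)) :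
    h3 (-1 / τ) (z / τ) = exp (π * I * z ^ 2 / τ) *
      (τ * g3 τ z - τ * qPow τ (-1 / 8) * theta00 τ z +
        1 / 2 * (-I * τ) ^ (1 / 2 : ℂ) * theta00 τ z) := by
  have h0 := ne_zero_of_im_pos hτ
  have hw : OffLattice τ (z + τ / 2) := hz.add 1 0 (by push_cast; ring)
  have e1 : exp (π * I * z + π * I * τ / 4) * exp (-(π * I * (z + τ / 2))) =
      exp (-(π * I * τ / 4)) := by
    rw [← exp_add]
    congr 1
    ring
  -- The two half-periods add up to τ, so theta returns to z with a multiplier; the exponentials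
  -- then collapse to q^{-1/8} in one theta term and to 1 in the other.
  have e2 : exp (π * I * z + π * I * τ / 4) * (exp (π * I * (z + τ / 2)) *
      exp (-π * I * (τ + 2 * z))) = qPow τ (-1 / 8) := by
    rw [qPow, ← exp_add, ← exp_add]
    congr 1
    ring
  have e3 : exp (π * I * z + π * I * τ / 4) * (exp (π * I * τ / 4 + π * I * (z + τ / 2)) *
      exp (-π * I * (τ + 2 * z))) = 1 := by
    rw [← exp_add, ← exp_add]
    refine (congrArg exp ?_).trans exp_zero
    ring
  rw [h3_eq, g3_eq, div_add_half h0, lerchSum_numerator_tau_inversion hτ hw,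
    exp_sq_add_half_tau h0, theta00, show z + τ / 2 + τ / 2 = z + τ by ring,
    jacobiTheta₂_add_left', ← e1, ← e2]
  linear_combination exp (π * I * z ^ 2 / τ) * (1 / 2 * (-I * τ) ^ (1 / 2 : ℂ)) *
    jacobiTheta₂ z τ * e3

theorem h4_inversion {τ z : ℂ} (hτ : 0 < τ.im)
    (hz : OffLattice τ (z - (1 + τ) / 2)) :
    h4 (-1 / τ) (z / τ) = exp (π * I * z ^ 2 / τ) *
      (τ * g4 τ z - τ * qPow τ (-1 / 8) * theta01 τ z +
        1 / 2 * (-I * τ) ^ (1 / 2 : ℂ) * theta01 τ z) := by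
  have h0 := ne_zero_of_im_pos hτ
  have hw : OffLattice τ (z + (1 + τ) / 2 - 1) := hz.add 1 0 (by push_cast; ring)
  have e1 : -I * exp (π * I * z + π * I * τ / 4) * exp (-(π * I * (z + (1 + τ) / 2 - 1))) =
      exp (-(π * I * τ / 4)) := by
    rw [neg_I_mul_exp, ← exp_add]
    congr 1
    ring
  have e2 : -I * exp (π * I * z + π * I * τ / 4) * (exp (π * I * (z + (1 + τ) / 2 - 1)) *
      exp (-π * I * (τ + 2 * (z - 1 / 2)))) = qPow τ (-1 / 8) := by
    rw [qPow, neg_I_mul_exp, ← exp_add, ← exp_add]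
    congr 1
    ring
  have e3 : -I * exp (π * I * z + π * I * τ / 4) *
      (exp (π * I * τ / 4 + π * I * (z + (1 + τ) / 2 - 1)) *
        exp (-π * I * (τ + 2 * (z - 1 / 2)))) = 1 := by
    rw [neg_I_mul_exp, ← exp_add, ← exp_add]
    refine (congrArg exp ?_).trans exp_zero
    ring
  have t : jacobiTheta₂ (z + (1 + τ) / 2 - 1 + τ / 2) τ =
      exp (-π * I * (τ + 2 * (z - 1 / 2))) * jacobiTheta₂ (z + 1 / 2) τ := by
    rw [show z + (1 + τ) / 2 - 1 + τ / 2 = z - 1 / 2 + τ by ring, jacobiTheta₂_add_left',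
      ← jacobiTheta₂_sub_one τ (z + 1 / 2), show z + 1 / 2 - 1 = z - 1 / 2 by ring]
  rw [h4_eq, g4_eq, div_add_half_add_inversion h0, lerchSum_numerator_tau_inversion hτ hw,
    ← mul_assoc, exp_mul_exp_sq_add_half_sub_one h0, theta01, t, lerchSum_sub_one, ← e1, ← e2]
  linear_combination exp (π * I * z ^ 2 / τ) * (1 / 2 * (-I * τ) ^ (1 / 2 : ℂ)) *
    jacobiTheta₂ (z + 1 / 2) τ * e3

/-! ### T-transformation: a numerator shift by 1/2, with eighth roots of unity coming from q^{±1/8}.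
-/

section T

variable (τ z : ℂ)

theorem lerchSum_half_add_one_left : lerchSum (τ + 1) (1 / 2) z = lerchSum τ 0 z := by
  rw [lerchSum_add_one_left, ← lerchSum_add_numerator_one τ 0]
  norm_num

theorem lerchSum_numerator_tau_add_one_left :
    lerchSum (τ + 1) (-(τ + 1) / 2) z = lerchSum τ (-τ / 2) z := by
  rw [lerchSum_add_one_left]
  congr 1
  ring

theorem exp_add_one_quarter :
    exp (π * I * z + π * I * (τ + 1) / 4) =
      exp (π * I / 4) * exp (π * I * z + π * I * τ / 4) := by
  rw [← exp_add]
  congr 1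
  ring

theorem exp_neg_add_one_quarter :
    exp (-(π * I * (τ + 1) / 4)) = exp (-(π * I / 4)) * exp (-(π * I * τ / 4)) := by
  rw [← exp_add]
  congr 1
  ring

theorem add_half_add_one : z + (τ + 1) / 2 = z + (1 + τ) / 2 := by ring

theorem lerchSum_add_half_add_one (τ' c : ℂ) :
    lerchSum τ' c (z + (1 + (τ + 1)) / 2) = lerchSum τ' c (z + τ / 2) := by
  rw [show z + (1 + (τ + 1)) / 2 = z + τ / 2 + 1 by ring, lerchSum_add_one]

theorem f1_translation : f1 (τ + 1) z = h1 τ z := by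
  rw [f1_eq, h1_eq, lerchSum_add_one_left, zero_add]

theorem f2_translation : f2 (τ + 1) z = exp (π * I / 4) * h2 τ z := by
  rw [f2_eq, h2_eq, lerchSum_add_half_add_one, lerchSum_add_one_left, zero_add,
    exp_add_one_quarter, mul_assoc]

theorem f3_translation : f3 (τ + 1) z = h3 τ z := by
  rw [f3_eq, h3_eq, lerchSum_add_one_left, zero_add]

theorem f4_translation : f4 (τ + 1) z = exp (π * I / 4) * h4 τ z := by
  rw [f4_eq, h4_eq, add_half_add_one, lerchSum_add_one_left, zero_add, exp_add_one_quarter,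
    mul_assoc]

theorem g1_translation : g1 (τ + 1) z = g1 τ z := by
  rw [g1_eq, g1_eq, lerchSum_numerator_tau_add_one_left]

theorem g2_translation : g2 (τ + 1) z = g2 τ z := by
  rw [g2_eq, g2_eq, lerchSum_numerator_tau_add_one_left]

theorem g3_translation : g3 (τ + 1) z = exp (-(π * I / 4)) * g4 τ z := by
  rw [g3_eq, g4_eq, add_half_add_one, lerchSum_numerator_tau_add_one_left,
    exp_neg_add_one_quarter, mul_assoc]

theorem g4_translation : g4 (τ + 1) z = exp (-(π * I / 4)) * g3 τ z := by
  rw [g4_eq, g3_eq, lerchSum_add_half_add_one, lerchSum_numerator_tau_add_one_left,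
    exp_neg_add_one_quarter, mul_assoc]

theorem h1_translation : h1 (τ + 1) z = f1 τ z := by
  rw [h1_eq, f1_eq, lerchSum_half_add_one_left]

theorem h2_translation : h2 (τ + 1) z = exp (π * I / 4) * f2 τ z := by
  rw [h2_eq, f2_eq, add_half_add_one, lerchSum_half_add_one_left, exp_add_one_quarter, mul_assoc]

theorem h3_translation : h3 (τ + 1) z = f3 τ z := by
  rw [h3_eq, f3_eq, lerchSum_half_add_one_left]

theorem h4_translation : h4 (τ + 1) z = exp (π * I / 4) * f4 τ z := by
  rw [h4_eq, f4_eq, lerchSum_add_half_add_one, lerchSum_half_add_one_left, exp_add_one_quarter,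
    mul_assoc]

end T

end AppellSum

theorem mainTheorem6 (τ z : ℂ) (hτ : 0 < τ.im) :
    -- S-transformation
    ((OffLattice τ z →
      f1 (-1 / τ) (z / τ) = exp (π * I * z ^ 2 / τ) *
        (τ * f1 τ z - 1 / 2 * τ * theta00 τ z + 1 / 2 * (-I * τ) ^ (1 / 2 : ℂ) * theta00 τ z)) ∧
     (OffLattice τ (z - (1 + τ) / 2) →
      f2 (-1 / τ) (z / τ) = exp (π * I * z ^ 2 / τ) *
        (-I * τ * f2 τ z + 1 / 2 * τ * theta11 τ z - 1 / 2 * (-I * τ) ^ (1 / 2 : ℂ) * theta11 τ z)) ∧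
     (OffLattice τ (z - τ / 2) →
      f3 (-1 / τ) (z / τ) = exp (π * I * z ^ 2 / τ) *
        (τ * f4 τ z - 1 / 2 * τ * theta10 τ z + 1 / 2 * (-I * τ) ^ (1 / 2 : ℂ) * theta10 τ z)) ∧
     (OffLattice τ (z - 1 / 2) →
      f4 (-1 / τ) (z / τ) = exp (π * I * z ^ 2 / τ) *
        (τ * f3 τ z - 1 / 2 * τ * theta01 τ z + 1 / 2 * (-I * τ) ^ (1 / 2 : ℂ) * theta01 τ z)) ∧
     (OffLattice τ z →
      g1 (-1 / τ) (z / τ) = exp (π * I * z ^ 2 / τ) * (τ * h1 τ z - 1 / 2 * τ * theta01 τ z) +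
        (-I * τ) ^ (1 / 2 : ℂ) * exp (π * I / τ * (z ^ 2 + 1 / 4)) * theta01 τ z) ∧
     (OffLattice τ (z - τ / 2) →
      g2 (-1 / τ) (z / τ) = exp (π * I * z ^ 2 / τ) * (I * τ * h2 τ z - 1 / 2 * τ * theta11 τ z) +
        (-I * τ) ^ (1 / 2 : ℂ) * exp (π * I / τ * (z ^ 2 + 1 / 4)) * theta11 τ z) ∧
     (OffLattice τ (z - 1 / 2) →
      g3 (-1 / τ) (z / τ) = exp (π * I * z ^ 2 / τ) * (τ * h3 τ z - 1 / 2 * τ * theta00 τ z) +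
        (-I * τ) ^ (1 / 2 : ℂ) * exp (π * I / τ * (z ^ 2 + 1 / 4)) * theta00 τ z) ∧
     (OffLattice τ (z - (1 + τ) / 2) →
      g4 (-1 / τ) (z / τ) = exp (π * I * z ^ 2 / τ) * (τ * h4 τ z - 1 / 2 * τ * theta10 τ z) +
        (-I * τ) ^ (1 / 2 : ℂ) * exp (π * I / τ * (z ^ 2 + 1 / 4)) * theta10 τ z) ∧
     (OffLattice τ z →
      h1 (-1 / τ) (z / τ) = exp (π * I * z ^ 2 / τ) *
        (τ * g1 τ z - τ * qPow τ (-1 / 8) * theta10 τ z +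
          1 / 2 * (-I * τ) ^ (1 / 2 : ℂ) * theta10 τ z)) ∧
     (OffLattice τ (z - 1 / 2) →
      h2 (-1 / τ) (z / τ) = exp (π * I * z ^ 2 / τ) *
        (I * τ * g2 τ z + τ * qPow τ (-1 / 8) * theta11 τ z -
          1 / 2 * (-I * τ) ^ (1 / 2 : ℂ) * theta11 τ z)) ∧
     (OffLattice τ (z - τ / 2) →
      h3 (-1 / τ) (z / τ) = exp (π * I * z ^ 2 / τ) *
        (τ * g3 τ z - τ * qPow τ (-1 / 8) * theta00 τ z +
          1 / 2 * (-I * τ) ^ (1 / 2 : ℂ) * theta00 τ z)) ∧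
     (OffLattice τ (z - (1 + τ) / 2) →
      h4 (-1 / τ) (z / τ) = exp (π * I * z ^ 2 / τ) *
        (τ * g4 τ z - τ * qPow τ (-1 / 8) * theta01 τ z +
          1 / 2 * (-I * τ) ^ (1 / 2 : ℂ) * theta01 τ z))) ∧
    -- T-transformation
    ((OffLattice τ z → f1 (τ + 1) z = h1 τ z) ∧
     (OffLattice τ (z - τ / 2) → f2 (τ + 1) z = exp (π * I / 4) * h2 τ z) ∧
     (OffLattice τ (z - 1 / 2) → f3 (τ + 1) z = h3 τ z) ∧
     (OffLattice τ (z - (1 + τ) / 2) → f4 (τ + 1) z = exp (π * I / 4) * h4 τ z) ∧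
     (OffLattice τ z → g1 (τ + 1) z = g1 τ z) ∧
     (OffLattice τ (z - 1 / 2) → g2 (τ + 1) z = g2 τ z) ∧
     (OffLattice τ (z - (1 + τ) / 2) → g3 (τ + 1) z = exp (-(π * I / 4)) * g4 τ z) ∧
     (OffLattice τ (z - τ / 2) → g4 (τ + 1) z = exp (-(π * I / 4)) * g3 τ z) ∧
     (OffLattice τ z → h1 (τ + 1) z = f1 τ z) ∧
     (OffLattice τ (z - (1 + τ) / 2) → h2 (τ + 1) z = exp (π * I / 4) * f2 τ z) ∧
     (OffLattice τ (z - 1 / 2) → h3 (τ + 1) z = f3 τ z) ∧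
     (OffLattice τ (z - τ / 2) → h4 (τ + 1) z = exp (π * I / 4) * f4 τ z)) := by
  exact ⟨⟨f1_inversion hτ, f2_inversion hτ, f3_inversion hτ, f4_inversion hτ, g1_inversion hτ,
    g2_inversion hτ, g3_inversion hτ, g4_inversion hτ, h1_inversion hτ, h2_inversion hτ,
    h3_inversion hτ, h4_inversion hτ⟩, ⟨fun _ => f1_translation τ z,
    fun _ => f2_translation τ z, fun _ => f3_translation τ z, fun _ => f4_translation τ z,
    fun _ => g1_translation τ z, fun _ => g2_translation τ z, fun _ => g3_translation τ z,
    fun _ => g4_translation τ z, fun _ => h1_translation τ z, fun _ => h2_translation τ z,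
    fun _ => h3_translation τ z, fun _ => h4_translation τ z⟩⟩
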